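/- Let $V$ be a left vector space of finite dimension $n$ over a division ring $R$, and let $V'$ be a left vector space of finite dimension $n'$ over a division ring $R'$. For $0\le k\le n$ let ${\mathcal G}_k(V)$ be the set of all $k$-dimensional subspaces of $V$, and let the Grassmann graph $\Gamma_k(V)$ be the graph with vertex set ${\mathcal G}_k(V)$ in which two distinct subspaces are adjacent if their intersection is $(k-1)$-dimensional; ${\mathcal G}_{k'}(V')$ and $\Gamma_{k'}(V')$, $0\le k'\le n'$, are defined in the same way. The Johnson graph $J(n,k)$ is the graph whose vertices are the $k$-element subsets of $\{1,\dots,n\}$, two distinct ones being adjacent if their intersection has $k-1$ elements. All these graphs are connected. An isometric embedding of a connected graph $\Gamma$ in a connected graph $\Gamma'$ is an injection of the vertex set of $\Gamma$ to the vertex set of $\Gamma'$ which sends adjacent vertices to adjacent vertices and non-adjacent vertices to non-adjacent vertices, and which preserves the path distance between any two vertices. For a base $B$ of $V$, the associated apartment of ${\mathcal G}_k(V)$ consists of all $k$-dimensional subspaces of $V$ spanned by subsets of $B$. A $J(n,k)$-subset of ${\mathcal G}_{k'}(V')$ is the image of an isometric embedding of $J(n,k)$ in $\Gamma_{k'}(V')$.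 A mapping $f:{\mathcal G}_k(V)\to{\mathcal G}_{k'}(V')$ is called a $J$-mapping if for every apartment ${\mathcal A}$ of ${\mathcal G}_k(V)$ the image $f({\mathcal A})$ is a $J(n,k)$-subset of ${\mathcal G}_{k'}(V')$. Theorem. Every $J$-mapping $f:{\mathcal G}_k(V)\to{\mathcal G}_{k'}(V')$ is an isometric embedding of $\Gamma_k(V)$ in $\Gamma_{k'}(V')$. -/

import Mathlib

namespace GrassmannJohnson

/-- The Grassmannian `G_k(V)`: the `k`-dimensional subspaces of the left vector space `V`. -/
abbrev Grassmannian (R V : Type*) [DivisionRing R] [AddCommGroup V] [Module R V] (k : ℕ) :=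
  {S : Submodule R V // Module.finrank R S = k}

/-- The Grassmann graph `Γ_k(V)`: two distinct `k`-dimensional subspaces are adjacent when their
intersection has dimension `k - 1`. -/
def grassmannGraph (R V : Type*) [DivisionRing R] [AddCommGroup V] [Module R V] (k : ℕ) :
    SimpleGraph (Grassmannian R V k) where
  Adj S U := S ≠ U ∧ Module.finrank R (S.1 ⊓ U.1 : Submodule R V) + 1 = k
  symm := ⟨fun S U h => ⟨h.1.symm, by rw [inf_comm]; exact h.2⟩⟩
  loopless := ⟨fun _ h => h.1 rfl⟩

/-- The Johnson graph `J(n,k)`: its vertices are the `k`-element subsets of an `n`-element set, and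
two distinct ones are adjacent when their intersection has `k - 1` elements. -/
def johnsonGraph (n k : ℕ) : SimpleGraph {X : Finset (Fin n) // X.card = k} where
  Adj X Y := X ≠ Y ∧ (X.1 ∩ Y.1).card + 1 = k
  symm := ⟨fun X Y h => ⟨h.1.symm, by rw [Finset.inter_comm]; exact h.2⟩⟩
  loopless := ⟨fun _ h => h.1 rfl⟩

/-- A map of vertex sets is an isometric embedding of graphs if it is injective, sends adjacent
vertices to adjacent ones and non-adjacent vertices to non-adjacent ones, and preserves the
distance. (It is applied here to Johnson and Grassmann graphs only, which are connected.) -/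
structure IsIsometricEmbedding {α β : Type*} (G : SimpleGraph α) (H : SimpleGraph β)
    (f : α → β) : Prop where
  injective : Function.Injective f
  adj_iff : ∀ x y, H.Adj (f x) (f y) ↔ G.Adj x y
  dist_eq : ∀ x y, H.dist (f x) (f y) = G.dist x y

/-- The apartment of `G_k(V)` associated with a base of `V`: all `k`-dimensional subspaces that are
spanned by subsets of the base. -/
def apartment {R V ι : Type*} [DivisionRing R] [AddCommGroup V] [Module R V]
    (b : Module.Basis ι R V) (k : ℕ) : Set (Grassmannian R V k) :=
  {P | ∃ X : Set V, X ⊆ Set.range b ∧ P.1 = Submodule.span R X}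

/-- A set of `k`-dimensional subspaces is an apartment if it is associated with some base. -/
def IsApartment {R V : Type*} [DivisionRing R] [AddCommGroup V] [Module R V] {k : ℕ}
    (A : Set (Grassmannian R V k)) : Prop :=
  ∃ b : Module.Basis (Fin (Module.finrank R V)) R V, A = apartment b k

/-- `J(n,k)`-subsets of `G_{k'}(V')`: the images of the isometric embeddings of the Johnson graph
`J(n,k)` in the Grassmann graph `Γ_{k'}(V')`. -/
def IsJohnsonSubset {R' V' : Type*} [DivisionRing R'] [AddCommGroup V'] [Module R' V']
    (n k : ℕ) {k' : ℕ} (J : Set (Grassmannian R' V' k')) : Prop :=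
  ∃ g : {X : Finset (Fin n) // X.card = k} → Grassmannian R' V' k',
    IsIsometricEmbedding (johnsonGraph n k) (grassmannGraph R' V' k') g ∧ J = Set.range g

/-- `J`-mappings: maps from `G_k(V)` to `G_{k'}(V')` that send every apartment of `G_k(V)` onto a
`J(n,k)`-subset of `G_{k'}(V')`, where `n = dim V`. -/
def IsJMapping {R V R' V' : Type*} [DivisionRing R] [AddCommGroup V] [Module R V]
    [DivisionRing R'] [AddCommGroup V'] [Module R' V'] {k k' : ℕ}
    (f : Grassmannian R V k → Grassmannian R' V' k') : Prop :=
  ∀ A : Set (Grassmannian R V k), IsApartment A →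
    IsJohnsonSubset (Module.finrank R V) k (f '' A)

end GrassmannJohnson

/-! Any two subspaces lie in a common apartment. On an apartment, `f` is `g ∘ σ`, where `g` is an
isometric embedding of J(n,k) and `σ` permutes the `k`-element index sets. So `f` is injective, and
it remains to show that `σ` preserves the sizes of intersections. If `k ≤ 1` or `n - k ≤ 1` this is
automatic, since J(n,k) is complete.

Otherwise replace the base vector `b i` by `b i + b j`. The apartment loses exactly the subspaces
whose index set contains `i` but not `j`, and there are `(n-2).choose (k-1)` of them. By
injectivity, the two image J(n,k)-subsets differ by the same number of vertices. The heart is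
`exists_eq_filter`: in the labelling by `g`, the lost vertices are again all the sets that contain
some `i'` but not some `j'`. Since |X ∩ Y| · |(X ∪ Y)ᶜ| counts the families of this kind that
contain both `X` and `Y`, `card_inter_eq_of_perm` recovers intersections from them.

For the heart, complementation allows `2 * k ≤ n`. An embedding sends all stars (sets over a common
`(k-1)`-set) into stars or all into tops (elements below a common upper cover), and lattice duality
exchanges the two cases. A star-preserving embedding is given by a frame: `g X` is the join over `X`
of covers of one element, any `2 * k` of them independent modulo it. If two frames share enough
vertices to separate indices, intersecting shared vertices identifies their points, and nothing is
lost. So some pair `(i, j)` is not separated, and its family, which has the right size, is lost. In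
the mixed case with `2 * k < n`, incidences of points with hyperplanes form small blocks, each
shared vertex lies in `k` blocks, and double counting gives a contradiction, with a parity argument
for `n = 5`, `k = 2`. -/

namespace GrassmannJohnson

/-! ### Lattices with a rank function -/

/-- An integer-valued rank function on a lattice: a strictly monotone valuation. -/
structure IsRank {L : Type*} [Lattice L] (r : L → ℤ) : Prop where
  strictMono : StrictMono r
  sup_add_inf : ∀ x y, r (x ⊔ y) + r (x ⊓ y) = r x + r y

namespace IsRank

variable {L : Type*} [Lattice L] {r : L → ℤ}

/-- Reversing the order negates the rank, so ranks take values in ℤ. This makes every lemma about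
stars also one about tops. -/
theorem dual (h : IsRank r) : IsRank (fun x : Lᵒᵈ => -r (OrderDual.ofDual x)) where
  strictMono := fun _ _ hxy => neg_lt_neg (h.strictMono hxy)
  sup_add_inf := fun x y => by
    have := h.sup_add_inf (OrderDual.ofDual x) (OrderDual.ofDual y)
    simp only [ofDual_sup, ofDual_inf]
    linarith

theorem eq_of_le (h : IsRank r) {x y : L} (hxy : x ≤ y) (hr : r y ≤ r x) : x = y := by
  by_contra hne
  exact absurd (h.strictMono (lt_of_le_of_ne hxy hne)) (not_lt.2 hr)

theorem add_le_inf_add (h : IsRank r) {x y z : L} (hx : x ≤ z) (hy : y ≤ z) :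
    r x + r y ≤ r (x ⊓ y) + r z := by
  have h1 := h.sup_add_inf x y
  have h2 := h.strictMono.monotone (sup_le hx hy)
  linarith

theorem sup_add_le (h : IsRank r) {x y z : L} (hx : z ≤ x) (hy : z ≤ y) :
    r (x ⊔ y) + r z ≤ r x + r y := by
  have h1 := h.sup_add_inf x y
  have h2 := h.strictMono.monotone (le_inf hx hy)
  linarith

/-- Three pairwise adjacent elements have a common lower cover or a common upper cover. -/
theorem inf_le_or_le_sup (h : IsRank r) {x y z : L} {c : ℤ} (hz : r z = c)
    (hxy : r (x ⊓ y) = c - 1) (hxz : r (x ⊓ z) = c - 1) (hyz : r (y ⊓ z) = c - 1) :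
    x ⊓ y ≤ z ∨ z ≤ x ⊔ y := by
  -- Equal meets give the common lower cover. Distinct ones are two hyperplanes of `z`, so they span
  -- it inside `x ⊔ y`.
  by_cases he : x ⊓ z = y ⊓ z
  · left
    have : x ⊓ z ≤ x ⊓ y := le_inf inf_le_left (he ▸ inf_le_left)
    rw [← h.eq_of_le this (by omega)]
    exact inf_le_right
  · right
    have h1 : x ⊓ z ⊔ y ⊓ z ≤ z := sup_le inf_le_right inf_le_right
    have h2 : r (x ⊓ z) < r (x ⊓ z ⊔ y ⊓ z) := by
      refine h.strictMono (lt_of_le_of_ne le_sup_left fun h3 => he ?_)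
      exact (h.eq_of_le (h3 ▸ le_sup_right : y ⊓ z ≤ x ⊓ z) (by omega)).symm
    rw [← h.eq_of_le h1 (by omega)]
    exact sup_le_sup inf_le_left inf_le_left

end IsRank

/-! ### Johnson embeddings: stars and tops -/

/-- The restriction of `g` to `k`-element sets is an isometric embedding of a Johnson graph in the
set of elements of rank `c`, with the distance expressed through ranks. -/
def IsJohnsonEmbedding {ι L : Type*} [DecidableEq ι] [Lattice L] (r : L → ℤ) (k : ℕ) (c : ℤ)
    (g : Finset ι → L) : Prop :=
  ∀ X Y : Finset ι, X.card = k → Y.card = k → r (g X ⊓ g Y) = c - (X \ Y).card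

/-- Sets with a common `(k - 1)`-element subset are sent to elements with a common lower cover. -/
def IsStarPreserving {ι L : Type*} [DecidableEq ι] [Lattice L] (k : ℕ) (g : Finset ι → L) : Prop :=
  ∀ (Z : Finset ι) (a b d : ι), Z.card + 1 = k → a ∉ Z → b ∉ Z → d ∉ Z → a ≠ b → a ≠ d → b ≠ d →
    g (insert a Z) ⊓ g (insert b Z) ≤ g (insert d Z)

section Embedding

variable {ι L : Type*} [DecidableEq ι] [Lattice L] {r : L → ℤ} {k : ℕ} {c : ℤ} {g : Finset ι → L}

theorem IsJohnsonEmbedding.rank (hg : IsJohnsonEmbedding r k c g) {X : Finset ι}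
    (hX : X.card = k) : r (g X) = c := by
  simpa using hg X X hX hX

theorem IsJohnsonEmbedding.rank_sup (h : IsRank r) (hg : IsJohnsonEmbedding r k c g)
    {X Y : Finset ι} (hX : X.card = k) (hY : Y.card = k) :
    r (g X ⊔ g Y) = c + (X \ Y).card := by
  have h1 := h.sup_add_inf (g X) (g Y)
  rw [hg X Y hX hY, hg.rank hX, hg.rank hY] at h1
  linarith

theorem IsJohnsonEmbedding.dual (h : IsRank r) (hg : IsJohnsonEmbedding r k c g) :
    IsJohnsonEmbedding (fun x : Lᵒᵈ => -r (OrderDual.ofDual x)) k (-c)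
      (fun X => OrderDual.toDual (g X)) := by
  intro X Y hX hY
  simp only [ofDual_inf, OrderDual.ofDual_toDual]
  rw [hg.rank_sup h hX hY]
  ring

theorem IsJohnsonEmbedding.rank_inf_one (hg : IsJohnsonEmbedding r k c g) {X Y : Finset ι} {u : ι}
    (hX : X.card = k) (hY : Y.card = k) (hu : X \ Y = {u}) : r (g X ⊓ g Y) = c - 1 := by
  rw [hg X Y hX hY, hu]
  simp

/-- Two vertices at distance two have no common lower cover. -/
theorem IsJohnsonEmbedding.false_of_le (h : IsRank r) (hg : IsJohnsonEmbedding r k c g)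
    {X Y : Finset ι} {u v : ι} (hX : X.card = k) (hY : Y.card = k) (hu : X \ Y = {u, v})
    (huv : u ≠ v) {m : L} (hm : r m = c - 1) (h1 : m ≤ g X) (h2 : m ≤ g Y) : False := by
  have h3 := h.strictMono.monotone (le_inf h1 h2)
  rw [hg X Y hX hY, hu, Finset.card_pair huv] at h3
  push_cast at h3
  omega

/-- Two vertices at distance two have no common upper cover. -/
theorem IsJohnsonEmbedding.false_of_ge (h : IsRank r) (hg : IsJohnsonEmbedding r k c g)
    {X Y : Finset ι} {u v : ι} (hX : X.card = k) (hY : Y.card = k) (hu : X \ Y = {u, v})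
    (huv : u ≠ v) {m : L} (hm : r m = c + 1) (h1 : g X ≤ m) (h2 : g Y ≤ m) : False := by
  have h3 := h.strictMono.monotone (sup_le h1 h2)
  rw [hg.rank_sup h hX hY, hu, Finset.card_pair huv] at h3
  push_cast at h3
  omega

theorem insert_sdiff_insert_eq {Z : Finset ι} {a b : ι} (ha : a ∉ Z) (hab : a ≠ b) :
    insert a Z \ insert b Z = {a} := by
  ext x; grind

theorem IsJohnsonEmbedding.rank_inf_insert (hg : IsJohnsonEmbedding r k c g) {Z : Finset ι}
    (hZ : Z.card + 1 = k) {a b : ι} (ha : a ∉ Z) (hb : b ∉ Z) (hab : a ≠ b) :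
    r (g (insert a Z) ⊓ g (insert b Z)) = c - 1 :=
  hg.rank_inf_one (by rw [Finset.card_insert_of_notMem ha, hZ])
    (by rw [Finset.card_insert_of_notMem hb, hZ]) (insert_sdiff_insert_eq ha hab)

theorem IsJohnsonEmbedding.rank_sup_insert (h : IsRank r) (hg : IsJohnsonEmbedding r k c g)
    {Z : Finset ι} (hZ : Z.card + 1 = k) {a b : ι} (ha : a ∉ Z) (hb : b ∉ Z) (hab : a ≠ b) :
    r (g (insert a Z) ⊔ g (insert b Z)) = c + 1 := by
  rw [hg.rank_sup h (by rw [Finset.card_insert_of_notMem ha, hZ])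
    (by rw [Finset.card_insert_of_notMem hb, hZ]), insert_sdiff_insert_eq ha hab]
  simp

/-- A triangle of a star is sent into a star or into a top. -/
theorem IsJohnsonEmbedding.inf_le_or_le_sup (h : IsRank r) (hg : IsJohnsonEmbedding r k c g)
    {Z : Finset ι} (hZ : Z.card + 1 = k) {a b d : ι} (ha : a ∉ Z) (hb : b ∉ Z) (hd : d ∉ Z)
    (hab : a ≠ b) (had : a ≠ d) (hbd : b ≠ d) :
    g (insert a Z) ⊓ g (insert b Z) ≤ g (insert d Z) ∨
      g (insert d Z) ≤ g (insert a Z) ⊔ g (insert b Z) :=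
  h.inf_le_or_le_sup (hg.rank (by rw [Finset.card_insert_of_notMem hd, hZ]))
    (hg.rank_inf_insert hZ ha hb hab) (hg.rank_inf_insert hZ ha hd had)
    (hg.rank_inf_insert hZ hb hd hbd)

/-- A triangle of a star is not sent into a pencil. -/
theorem IsJohnsonEmbedding.not_pencil (h : IsRank r) (hg : IsJohnsonEmbedding r k c g) (hk : 2 ≤ k)
    {Z : Finset ι} (hZ : Z.card + 1 = k) {a b d : ι} (ha : a ∉ Z) (hb : b ∉ Z) (hd : d ∉ Z)
    (hab : a ≠ b) (had : a ≠ d) (hbd : b ≠ d)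
    (h1 : g (insert a Z) ⊓ g (insert b Z) ≤ g (insert d Z))
    (h2 : g (insert d Z) ≤ g (insert a Z) ⊔ g (insert b Z)) : False := by
  -- The set `Z - z + a + b` is adjacent to `Z + a` and `Z + b` but at distance two from `Z + d`. In
  -- a pencil, either position of its image relative to the first two images would make it too close
  -- to the third.
  obtain ⟨z, hz⟩ : Z.Nonempty := Finset.card_pos.1 (by omega)
  have cW : (insert a (insert b (Z.erase z))).card = k := by
    rw [Finset.card_insert_of_notMem (by grind), Finset.card_insert_of_notMem (by grind),
      Finset.card_erase_of_mem hz]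
    omega
  have ca : (insert a Z).card = k := by rw [Finset.card_insert_of_notMem ha, hZ]
  have cb : (insert b Z).card = k := by rw [Finset.card_insert_of_notMem hb, hZ]
  have cd : (insert d Z).card = k := by rw [Finset.card_insert_of_notMem hd, hZ]
  have e1 : insert a Z \ insert a (insert b (Z.erase z)) = {z} := by ext x; grind
  have e2 : insert b Z \ insert a (insert b (Z.erase z)) = {z} := by ext x; grind
  have e3 : insert a (insert b (Z.erase z)) \ insert d Z = {a, b} := by ext x; grind
  have hm := hg.rank_inf_insert hZ ha hb hab
  have hM := hg.rank_sup_insert h hZ ha hb hab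
  rcases h.inf_le_or_le_sup (hg.rank cW) hm (hg.rank_inf_one ca cW e1)
    (hg.rank_inf_one cb cW e2) with h3 | h3
  · exact hg.false_of_le h cW cd e3 hab hm h3 h1
  · exact hg.false_of_ge h cW cd e3 hab hM h3 h2

/-- If one triangle of a star is sent into a star, then so is the whole star. -/
theorem IsJohnsonEmbedding.star_of_triangle (h : IsRank r) (hg : IsJohnsonEmbedding r k c g)
    (hk : 2 ≤ k) {Z : Finset ι} (hZ : Z.card + 1 = k) {a b d : ι} (ha : a ∉ Z) (hb : b ∉ Z)
    (hd : d ∉ Z) (hab : a ≠ b) (had : a ≠ d) (hbd : b ≠ d)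
    (h1 : g (insert a Z) ⊓ g (insert b Z) ≤ g (insert d Z)) {a' b' d' : ι}
    (ha' : a' ∉ Z) (hb' : b' ∉ Z) (hd' : d' ∉ Z) (hab' : a' ≠ b') :
    g (insert a' Z) ⊓ g (insert b' Z) ≤ g (insert d' Z) := by
  have hm := hg.rank_inf_insert hZ ha hb hab
  have key : ∀ e, e ∉ Z → g (insert a Z) ⊓ g (insert b Z) ≤ g (insert e Z) := by
    intro e he
    rcases eq_or_ne a e with rfl | hae
    · exact inf_le_left
    rcases eq_or_ne b e with rfl | hbe
    · exact inf_le_right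
    rcases eq_or_ne d e with rfl | hde
    · exact h1
    rcases hg.inf_le_or_le_sup h hZ ha hb he hab hae hbe with h2 | h2
    · exact h2
    -- Since pencils are excluded, the image of `d` meets the top only in the common lower cover. An
    -- image of `e` in that top is adjacent to it and therefore contains this cover.
    have h3 : r (g (insert d Z) ⊓ (g (insert a Z) ⊔ g (insert b Z))) < r (g (insert d Z)) := by
      refine h.strictMono (lt_of_le_of_ne inf_le_left fun h4 => ?_)
      exact hg.not_pencil h hk hZ ha hb hd hab had hbd h1 (inf_eq_left.1 h4)
    rw [hg.rank (by rw [Finset.card_insert_of_notMem hd, hZ])] at h3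
    have h4 := h.eq_of_le (le_inf h1 (inf_le_left.trans le_sup_left) : _ ≤ g (insert d Z) ⊓
      (g (insert a Z) ⊔ g (insert b Z))) (by rw [hm]; omega)
    have h5 : g (insert d Z) ⊓ g (insert e Z) ≤ g (insert a Z) ⊓ g (insert b Z) :=
      h4 ▸ inf_le_inf_left _ h2
    rw [← h.eq_of_le h5 (by rw [hm, hg.rank_inf_insert hZ hd he hde])]
    exact inf_le_right
  rw [← h.eq_of_le (le_inf (key a' ha') (key b' hb'))
    (by rw [hm, hg.rank_inf_insert hZ ha' hb' hab'])]
  exact key d' hd'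

/-- Adjacent stars are not sent into a star and a top. -/
theorem IsJohnsonEmbedding.false_of_star_top (h : IsRank r) (hg : IsJohnsonEmbedding r k c g)
    {Y : Finset ι} (hY : Y.card + 2 = k) {x y a b : ι} (hx : x ∉ Y) (hy : y ∉ Y) (ha : a ∉ Y)
    (hb : b ∉ Y) (hxy : x ≠ y) (hxa : x ≠ a) (hxb : x ≠ b) (hya : y ≠ a) (hyb : y ≠ b)
    (hab : a ≠ b)
    (h1 : g (insert y (insert x Y)) ⊓ g (insert a (insert x Y)) ≤ g (insert b (insert x Y)))
    (h2 : g (insert b (insert y Y)) ≤ g (insert x (insert y Y)) ⊔ g (insert a (insert y Y))) :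
    False := by
  have card : ∀ u v : ι, u ∉ Y → v ∉ Y → u ≠ v → (insert u (insert v Y)).card = k := by
    intro u v hu hv huv
    rw [Finset.card_insert_of_notMem (by grind), Finset.card_insert_of_notMem hv]
    omega
  rw [Finset.insert_comm x y] at h2
  have c0 := card y x hy hx hxy.symm
  have c1 := card a x ha hx hxa.symm
  have c2 := card b x hb hx hxb.symm
  have c3 := card a y ha hy hya.symm
  have c4 := card b y hb hy hyb.symm
  have e1 : insert y (insert x Y) \ insert a (insert y Y) = {x} := by ext; grind
  have e2 : insert y (insert x Y) \ insert a (insert x Y) = {y} := by ext; grind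
  have e3 : insert a (insert y Y) \ insert a (insert x Y) = {y} := by ext; grind
  have e4 : insert a (insert x Y) \ insert b (insert y Y) = {a, x} := by ext; grind
  have e5 : insert b (insert x Y) \ insert a (insert y Y) = {b, x} := by ext; grind
  have hm := hg.rank_inf_one c0 c3 e1
  have hM := hg.rank_sup h c0 c3
  rw [e1, Finset.card_singleton, Nat.cast_one] at hM
  -- The triangle `Y + x + y`, `Y + a + y`, `Y + a + x` links the two stars. A common lower cover
  -- would also lie below `Y + b + x`, and a common upper cover above `Y + b + y`; each puts two
  -- vertices at distance two too close.
  rcases h.inf_le_or_le_sup (hg.rank c1) hm (hg.rank_inf_one c0 c1 e2)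
    (hg.rank_inf_one c3 c1 e3) with h3 | h3
  · have h4 := h.eq_of_le (le_inf inf_le_left h3)
      (by rw [hm, hg.rank_inf_one c0 c1 e2])
    exact hg.false_of_le h c2 c3 e5 hxb.symm hm (h4 ▸ h1) inf_le_right
  · exact hg.false_of_ge h c1 c4 e4 hxa.symm hM h3 h2

theorem exists_pair_notMem [Fintype ι] {X : Finset ι} (hX : X.card + 2 ≤ Fintype.card ι) :
    ∃ a b, a ∉ X ∧ b ∉ X ∧ a ≠ b := by
  have h1 : 1 < Xᶜ.card := by rw [Finset.card_compl]; omega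
  obtain ⟨a, ha, b, hb, hab⟩ := Finset.one_lt_card.1 h1
  exact ⟨a, b, Finset.mem_compl.1 ha, Finset.mem_compl.1 hb, hab⟩

/-- An embedding of a Johnson graph sends all stars into stars or all stars into tops. -/
theorem IsJohnsonEmbedding.isStarPreserving_or_dual [Fintype ι] (h : IsRank r)
    (hg : IsJohnsonEmbedding r k c g) (hk : 2 ≤ k) (hn : k + 2 ≤ Fintype.card ι) :
    IsStarPreserving k g ∨ IsStarPreserving k (fun X => OrderDual.toDual (g X)) := by
  by_cases hex : ∃ (Z : Finset ι) (a b d : ι), Z.card + 1 = k ∧ a ∉ Z ∧ b ∉ Z ∧ d ∉ Z ∧ a ≠ b ∧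
      a ≠ d ∧ b ≠ d ∧ g (insert a Z) ⊓ g (insert b Z) ≤ g (insert d Z)
  · left
    obtain ⟨Z₀, a, b, d, hZ₀, ha, hb, hd, hab, had, hbd, h0⟩ := hex
    have key : ∀ (m : ℕ) (Z : Finset ι), Z.card + 1 = k → (Z \ Z₀).card = m → ∀ a b d : ι,
        a ∉ Z → b ∉ Z → d ∉ Z → a ≠ b → g (insert a Z) ⊓ g (insert b Z) ≤ g (insert d Z) := by
      intro m
      induction m with
      | zero =>
        intro Z hZ hm a' b' d' ha' hb' hd' hab'
        have hZZ : Z = Z₀ := Finset.eq_of_subset_of_card_le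
          (Finset.sdiff_eq_empty_iff_subset.1 (Finset.card_eq_zero.1 hm)) (by omega)
        subst hZZ
        exact hg.star_of_triangle h hk hZ ha hb hd hab had hbd h0 ha' hb' hd' hab'
      | succ m ih =>
        intro Z hZ hm a' b' d' ha' hb' hd' hab'
        obtain ⟨y, hy⟩ : (Z \ Z₀).Nonempty := Finset.card_pos.1 (by omega)
        obtain ⟨x, hx⟩ : (Z₀ \ Z).Nonempty := by
          refine Finset.card_pos.1 ?_
          rw [Finset.card_sdiff_comm (t := Z) (by omega)]
          omega
        rw [Finset.mem_sdiff] at hx hy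
        have hYc : (Z.erase y).card + 2 = k := by
          rw [Finset.card_erase_of_mem hy.1]
          have := Finset.card_pos.2 ⟨y, hy.1⟩
          omega
        have hxy : x ≠ y := fun hxy => hx.2 (hxy ▸ hy.1)
        have hxY : x ∉ Z.erase y := fun h => hx.2 (Finset.mem_of_mem_erase h)
        have hyY : y ∉ Z.erase y := Finset.notMem_erase y Z
        -- The neighbouring star `Z - y + x` is closer to `Z₀`. Two spare indices outside `Z + x`
        -- exist because `k + 2 ≤ n`.
        obtain ⟨u, v, hu, hv, huv⟩ := exists_pair_notMem (X := insert x Z)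
          (by rw [Finset.card_insert_of_notMem hx.2]; omega)
        have hyZ : insert y (Z.erase y) = Z := Finset.insert_erase hy.1
        have hux : u ∉ Z := fun h => hu (Finset.mem_insert_of_mem h)
        have hvx : v ∉ Z := fun h => hv (Finset.mem_insert_of_mem h)
        have hx1 : x ≠ u := fun h => hu (h ▸ Finset.mem_insert_self _ _)
        have hx2 : x ≠ v := fun h => hv (h ▸ Finset.mem_insert_self _ _)
        have hy1 : y ≠ u := fun h => hux (h ▸ hy.1)
        have hy2 : y ≠ v := fun h => hvx (h ▸ hy.1)
        have hu' : u ∉ Z.erase y := fun h => hux (Finset.mem_of_mem_erase h)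
        have hv' : v ∉ Z.erase y := fun h => hvx (Finset.mem_of_mem_erase h)
        have h1 := ih (insert x (Z.erase y))
          (by rw [Finset.card_insert_of_notMem hxY]; omega)
          (by
            have : insert x (Z.erase y) \ Z₀ = (Z \ Z₀).erase y := by ext; grind
            rw [this, Finset.card_erase_of_mem (Finset.mem_sdiff.2 hy)]
            omega) y u v (by grind) (by grind) (by grind) hy1
        rcases hg.inf_le_or_le_sup h hZ hx.2 hux hvx hx1 hx2 huv with h2 | h2
        · exact hg.star_of_triangle h hk hZ hx.2 hux hvx hx1 hx2 huv h2 ha' hb' hd' hab'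
        · rw [← hyZ] at h2
          exact (hg.false_of_star_top h hYc hxY hyY hu' hv' hxy hx1 hx2 hy1 hy2 huv h1 h2).elim
    exact fun Z a b d hZ ha hb hd hab _ _ => key _ Z hZ rfl a b d ha hb hd hab
  · right
    intro Z a b d hZ ha hb hd hab had hbd
    refine (hg.inf_le_or_le_sup h hZ ha hb hd hab had hbd).resolve_left fun h1 => ?_
    exact hex ⟨Z, a, b, d, hZ, ha, hb, hd, hab, had, hbd, h1⟩

end Embedding

/-! ### Frames from star-preserving embeddings -/

/-- A frame of length `m` and rank `s`: a join-preserving map of nonempty index sets to a lattice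
such that the rank of the image of a set of at most `m` indices is `s` plus its cardinality. -/
structure IsFrame {ι L : Type*} [DecidableEq ι] [Lattice L] (r : L → ℤ) (m : ℕ) (s : ℤ)
    (P : Finset ι → L) : Prop where
  union : ∀ X Y, P (X ∪ Y) = P X ⊔ P Y
  rank : ∀ X : Finset ι, X.card ≤ m → r (P X) = s + X.card

section Frame

variable {ι L : Type*} [DecidableEq ι] [Lattice L] {r : L → ℤ} {k : ℕ} {c : ℤ} {g : Finset ι → L}

/-- A star-preserving embedding of `J(n,k)` induces one of `J(n,k-1)`, by sending a
`(k-1)`-element set to the meet of the image of its star. -/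
theorem IsJohnsonEmbedding.exists_pred [Fintype ι] (h : IsRank r)
    (hg : IsJohnsonEmbedding r (k + 1) c g) (hs : IsStarPreserving (k + 1) g) (hk : 1 ≤ k)
    (hn : 2 * (k + 1) ≤ Fintype.card ι) :
    ∃ e : Finset ι → L, IsJohnsonEmbedding r k (c - 1) e ∧ IsStarPreserving k e ∧
      ∀ Z : Finset ι, Z.card = k → ∀ a ∉ Z, e Z ≤ g (insert a Z) := by
  have hex : ∀ Z : Finset ι, ∃ m : L, Z.card = k → r m = c - 1 ∧ ∀ a ∉ Z, m ≤ g (insert a Z) := by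
    intro Z
    by_cases hZ : Z.card = k
    · obtain ⟨a, b, ha, hb, hab⟩ := exists_pair_notMem (X := Z) (by omega)
      refine ⟨g (insert a Z) ⊓ g (insert b Z), fun _ =>
        ⟨hg.rank_inf_insert (by omega) ha hb hab, fun d hd => ?_⟩⟩
      rcases eq_or_ne a d with rfl | had
      · exact inf_le_left
      rcases eq_or_ne b d with rfl | hbd
      · exact inf_le_right
      exact hs Z a b d (by omega) ha hb hd hab had hbd
    · exact ⟨g ∅, fun h => absurd h hZ⟩
  choose e he using hex
  have hle : ∀ Z : Finset ι, Z.card = k → ∀ a ∉ Z, e Z ≤ g (insert a Z) :=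
    fun Z hZ => (he Z hZ).2
  have hre : ∀ Z : Finset ι, Z.card = k → r (e Z) = c - 1 := fun Z hZ => (he Z hZ).1
  have hemb : IsJohnsonEmbedding r k (c - 1) e := by
    intro Z Z' hZ hZ'
    rcases Finset.eq_empty_or_nonempty (Z \ Z') with h0 | hne
    · have : Z = Z' := Finset.eq_of_subset_of_card_le
        (Finset.sdiff_eq_empty_iff_subset.1 h0) (by omega)
      subst this
      simp [hre Z hZ]
    · apply le_antisymm
      -- Upper bound: adding distinct new indices to `Z` and `Z'` raises their distance by one. Room
      -- for them comes from `2 * (k + 1) ≤ n`.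
      · have hU := Finset.card_union_add_card_inter Z Z'
        have hI := Finset.card_sdiff_add_card_inter Z Z'
        have hp := Finset.card_pos.2 hne
        have hUn : (Z ∪ Z').card + 2 ≤ Fintype.card ι := by omega
        obtain ⟨a, b, ha, hb, hab⟩ := exists_pair_notMem hUn
        simp only [Finset.mem_union, not_or] at ha hb
        have h1 := h.strictMono.monotone (inf_le_inf (hle Z hZ a ha.1) (hle Z' hZ' b hb.2))
        rw [hg _ _ (by rw [Finset.card_insert_of_notMem ha.1, hZ])
          (by rw [Finset.card_insert_of_notMem hb.2, hZ'])] at h1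
        have h2 : insert a (Z \ Z') = insert a Z \ insert b Z' := by ext; grind
        rw [← h2, Finset.card_insert_of_notMem (by grind)] at h1
        push_cast at h1
        omega
      -- Lower bound: `Z + z'` and `Z' + z` are closer by one, and intersecting with `e Z` and `e
      -- Z'` costs at most one dimension each.
      · obtain ⟨z, hz⟩ := hne
        obtain ⟨z', hz'⟩ : (Z' \ Z).Nonempty := by
          refine Finset.card_pos.1 ?_
          rw [Finset.card_sdiff_comm (by omega)]
          exact Finset.card_pos.2 ⟨z, hz⟩
        have h2 : insert z' Z \ insert z Z' = (Z \ Z').erase z := by ext; grind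
        have hzc := Finset.card_erase_of_mem hz
        have hzp := Finset.card_pos.2 ⟨z, hz⟩
        rw [Finset.mem_sdiff] at hz hz'
        have c1 : (insert z' Z).card = k + 1 := by rw [Finset.card_insert_of_notMem hz'.2, hZ]
        have c2 : (insert z Z').card = k + 1 := by rw [Finset.card_insert_of_notMem hz.2, hZ']
        have h3 := hg _ _ c1 c2
        rw [h2, hzc] at h3
        have h4 := h.add_le_inf_add (hle Z hZ z' hz'.2)
          (inf_le_left : g (insert z' Z) ⊓ g (insert z Z') ≤ _)
        have h5 := h.add_le_inf_add
          (inf_le_right.trans inf_le_right : e Z ⊓ (g (insert z' Z) ⊓ g (insert z Z')) ≤ _)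
          (hle Z' hZ' z hz.2)
        have h6 := h.strictMono.monotone (inf_le_inf_right (e Z')
          (inf_le_left : e Z ⊓ (g (insert z' Z) ⊓ g (insert z Z')) ≤ e Z))
        rw [hg.rank c1, hre Z hZ] at h4
        rw [hg.rank c2, hre Z' hZ'] at h5
        omega
  refine ⟨e, hemb, ?_, hle⟩
  intro Y a b d hY ha hb hd hab had hbd
  have ca : (insert a Y).card = k := by rw [Finset.card_insert_of_notMem ha, hY]
  have cb : (insert b Y).card = k := by rw [Finset.card_insert_of_notMem hb, hY]
  have cd : (insert d Y).card = k := by rw [Finset.card_insert_of_notMem hd, hY]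
  -- A top would put the join of the images of `Y + a` and `Y + d`, of rank `c`, below two distinct
  -- adjacent values of `g`, whose meet has rank `c - 1`.
  refine (hemb.inf_le_or_le_sup h hY ha hb hd hab had hbd).resolve_right fun h1 => ?_
  have b1 : b ∉ insert a Y := by grind
  have a1 : a ∉ insert b Y := by grind
  have d1 : d ∉ insert a Y := by grind
  have a2 : a ∉ insert d Y := by grind
  have l1 : e (insert a Y) ≤ g (insert b (insert a Y)) := hle _ ca b b1
  have l2 : e (insert b Y) ≤ g (insert b (insert a Y)) := by
    rw [Finset.insert_comm]; exact hle _ cb a a1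
  have l3 : e (insert a Y) ≤ g (insert d (insert a Y)) := hle _ ca d d1
  have l4 : e (insert d Y) ≤ g (insert d (insert a Y)) := by
    rw [Finset.insert_comm]; exact hle _ cd a a2
  have l5 := h1.trans (sup_le l1 l2)
  have h6 := h.strictMono.monotone (le_inf (sup_le l1 l5) (sup_le l3 l4))
  rw [hemb.rank_sup_insert h hY ha hd had, hg.rank_inf_insert (by omega) b1 d1 hbd] at h6
  omega

/-- Descent through `exists_pred` reaches singletons, whose images are the covers `Q i` of `S`. On
the way back, `g X` is the join of the predecessors of two `k`-subsets with union `X`. -/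
theorem IsJohnsonEmbedding.exists_sup_eq [Fintype ι] [BoundedOrder L] (h : IsRank r) (hk : 1 ≤ k)
    (hg : IsJohnsonEmbedding r k c g) (hs : IsStarPreserving k g)
    (hn : 2 * k ≤ Fintype.card ι) :
    ∃ (S : L) (Q : ι → L), (∀ i, S ≤ Q i) ∧ r S = c - k ∧ (∀ i, r (Q i) = c - k + 1) ∧
      ∀ X : Finset ι, X.card = k → g X = S ⊔ X.sup Q := by
  induction k, hk using Nat.le_induction generalizing c g with
  | base =>
    obtain ⟨a, b, -, -, hab⟩ := exists_pair_notMem (ι := ι) (X := ∅) (by simp; omega)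
    have hle : ∀ i, g {a} ⊓ g {b} ≤ g {i} := by
      intro i
      rcases eq_or_ne a i with rfl | had
      · exact inf_le_left
      rcases eq_or_ne b i with rfl | hbd
      · exact inf_le_right
      exact hs ∅ a b i rfl (by simp) (by simp) (by simp) hab had hbd
    refine ⟨g {a} ⊓ g {b}, fun i => g {i}, hle, ?_, fun i => ?_, fun X hX => ?_⟩
    · exact_mod_cast hg.rank_inf_insert (Z := ∅) rfl (by simp) (by simp) hab
    · simpa using hg.rank (X := {i}) rfl
    · obtain ⟨i, rfl⟩ := Finset.card_eq_one.1 hX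
      simpa using hle i
  | succ k hk ih =>
    obtain ⟨e, he, hse, hle⟩ := hg.exists_pred h hs hk hn
    obtain ⟨S, Q, hSQ, hS, hQ, hX⟩ := ih he hse (by omega)
    refine ⟨S, Q, hSQ, by rw [hS]; push_cast; ring, fun i => by rw [hQ]; push_cast; ring,
      fun X hXc => ?_⟩
    obtain ⟨x, hx, y, hy, hxy⟩ := Finset.one_lt_card.1 (by omega : 1 < X.card)
    have cx : (X.erase x).card = k := by rw [Finset.card_erase_of_mem hx]; omega
    have cy : (X.erase y).card = k := by rw [Finset.card_erase_of_mem hy]; omega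
    have l1 := hle _ cx x (Finset.notMem_erase x X)
    have l2 := hle _ cy y (Finset.notMem_erase y X)
    rw [Finset.insert_erase hx] at l1
    rw [Finset.insert_erase hy] at l2
    have e1 : X.erase x \ X.erase y = {y} := by ext; grind
    have e2 : X.erase x ∪ X.erase y = X := by ext; grind
    have h1 := he.rank_sup h cx cy
    rw [e1] at h1
    rw [← h.eq_of_le (sup_le l1 l2) (by rw [h1, hg.rank hXc]; simp), hX _ cx, hX _ cy,
      ← sup_sup_distrib_left, ← Finset.sup_union, e2]

/-- A star-preserving embedding of `J(n,k)`, where `2 * k ≤ n`, comes from a frame. -/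
theorem IsJohnsonEmbedding.exists_isFrame [Fintype ι] [BoundedOrder L] (h : IsRank r) (hk : 1 ≤ k)
    (hg : IsJohnsonEmbedding r k c g) (hs : IsStarPreserving k g)
    (hn : 2 * k ≤ Fintype.card ι) :
    ∃ P : Finset ι → L, IsFrame r (2 * k) (c - k) P ∧
      ∀ X : Finset ι, X.card = k → g X = P X := by
  obtain ⟨S, Q, hSQ, hS, hQ, hX⟩ := hg.exists_sup_eq h hk hs hn
  refine ⟨fun X => S ⊔ X.sup Q, ⟨fun X Y => ?_, fun X hXc => ?_⟩, hX⟩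
  · rw [Finset.sup_union, sup_sup_distrib_left]
  have hmono : ∀ (Y X : Finset ι), r (S ⊔ (X ∪ Y).sup Q) ≤ r (S ⊔ X.sup Q) + Y.card := by
    intro Y X
    induction Y using Finset.induction_on with
    | empty => simp
    | insert i Y hi ih =>
      have h1 := h.sup_add_le (x := S ⊔ (X ∪ Y).sup Q) le_sup_left (hSQ i)
      have h2 : S ⊔ (X ∪ insert i Y).sup Q = S ⊔ (X ∪ Y).sup Q ⊔ Q i := by
        rw [Finset.union_insert, Finset.sup_insert, sup_comm (Q i), sup_assoc]
      rw [hQ, hS] at h1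
      rw [h2, Finset.card_insert_of_notMem hi]
      push_cast
      omega
  -- Each index raises the rank by at most one. A `2 * k`-set splits into two `k`-sets at distance
  -- `k`, so its join attains the maximal rank and no increment below it is lost.
  obtain ⟨W, hXW, -, hW⟩ := Finset.exists_subsuperset_card_eq (Finset.subset_univ X) hXc
    (by rwa [Finset.card_univ])
  obtain ⟨A, hAW, hA⟩ := Finset.exists_subset_card_eq (s := W) (n := k) (by omega)
  have hB : (W \ A).card = k := by rw [Finset.card_sdiff_of_subset hAW]; omega
  have h1 := hg.rank_sup h hA hB
  have h2 : A \ (W \ A) = A := by ext; grind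
  have h3 : A ∪ W \ A = W := by ext; grind
  rw [h2, hX _ hA, hX _ hB, ← sup_sup_distrib_left, ← Finset.sup_union, h3, hA] at h1
  have h4 := hmono (W \ X) X
  have h5 := hmono X ∅
  rw [Finset.union_sdiff_of_subset hXW, Finset.card_sdiff_of_subset hXW, h1] at h4
  simp only [Finset.empty_union, Finset.sup_empty, sup_bot_eq] at h5
  rw [hS] at h5
  omega

end Frame

/-! ### Comparing two frames -/

section Frame

variable {ι L : Type*} [DecidableEq ι] [Lattice L] {r : L → ℤ} {m k : ℕ} {s : ℤ}
  {P P' : Finset ι → L}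

namespace IsFrame

theorem mono (hP : IsFrame r m s P) {X Y : Finset ι} (hXY : X ⊆ Y) : P X ≤ P Y := by
  have h1 := hP.union X Y
  rw [Finset.union_eq_right.2 hXY] at h1
  rw [h1]
  exact le_sup_left

theorem inf_eq (h : IsRank r) (hP : IsFrame r m s P) {X Y : Finset ι} (hXY : (X ∪ Y).card ≤ m) :
    P X ⊓ P Y = P (X ∩ Y) := by
  have hX := Finset.card_le_card (Finset.subset_union_left : X ⊆ X ∪ Y)
  have hY := Finset.card_le_card (Finset.subset_union_right : Y ⊆ X ∪ Y)
  have hI := Finset.card_le_card (Finset.inter_subset_left : X ∩ Y ⊆ X)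
  refine (h.eq_of_le (le_inf (hP.mono Finset.inter_subset_left)
    (hP.mono Finset.inter_subset_right)) ?_).symm
  have h1 := h.sup_add_inf (P X) (P Y)
  rw [← hP.union, hP.rank _ hXY, hP.rank X (by omega), hP.rank Y (by omega)] at h1
  rw [hP.rank _ (by omega)]
  have := Finset.card_union_add_card_inter X Y
  omega

theorem le_iff (hP : IsFrame r m s P) {X : Finset ι} (hX : X.Nonempty) {y : L} :
    P X ≤ y ↔ ∀ i ∈ X, P {i} ≤ y := by
  induction hX using Finset.Nonempty.cons_induction with
  | singleton a => simp
  | cons a X ha hX ih =>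
    rw [Finset.cons_eq_insert, Finset.insert_eq, hP.union, sup_le_iff, ih]
    simp

/-- If the `k`-element sets with a common image under `P` and `P'` separate indices, then the
image of the `k`-element sets under `P` is contained in the image under `P'`. -/
theorem exists_eq_of_separating [Nontrivial ι] (h : IsRank r) (hP : IsFrame r (2 * k) s P)
    (hP' : IsFrame r (2 * k) s P') (hk : 1 ≤ k)
    (hsep : ∀ i j : ι, i ≠ j → ∃ X Y : Finset ι, X.card = k ∧ Y.card = k ∧ P X = P' Y ∧
      i ∈ X ∧ j ∉ X) (X : Finset ι) (hX : X.card = k) :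
    ∃ Y : Finset ι, Y.card = k ∧ P X = P' Y := by
  -- Intersecting with shared vertices that contain `i` shrinks `Z` to `{i}`. The unions have at
  -- most `2 * k` elements, so `inf_eq` applies in both frames.
  have key : ∀ (n : ℕ) (i : ι) (Z W : Finset ι), Z.card = n → i ∈ Z → Z.card ≤ k → W.card ≤ k →
      P Z = P' W → ∃ i', P {i} = P' {i'} := by
    intro n
    induction n using Nat.strong_induction_on with
    | _ n ih =>
      intro i Z W hn hi hZ hW hZW
      by_cases hj : ∃ j ∈ Z, i ≠ j
      · obtain ⟨j, hjZ, hij⟩ := hj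
        obtain ⟨X, Y, hX, hY, hXY, hiX, hjX⟩ := hsep i j hij
        have hlt : (Z ∩ X).card < Z.card := Finset.card_lt_card
          ⟨Finset.inter_subset_left, fun h => hjX (Finset.mem_inter.1 (h hjZ)).2⟩
        have hle : (W ∩ Y).card ≤ W.card := Finset.card_le_card Finset.inter_subset_left
        refine ih _ (hn ▸ hlt) i (Z ∩ X) (W ∩ Y) rfl (Finset.mem_inter.2 ⟨hi, hiX⟩) (by omega)
          (by omega) ?_
        have u1 := Finset.card_union_le Z X
        have u2 := Finset.card_union_le W Y
        rw [← hP.inf_eq h (by omega), ← hP'.inf_eq h (by omega), hZW, hXY]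
      · push Not at hj
        have hZi : Z = {i} := by
          ext x; rw [Finset.mem_singleton]
          exact ⟨fun hx => (hj x hx).symm, fun hx => hx ▸ hi⟩
        have h1 := hP.rank Z (by omega)
        rw [hZW, hP'.rank W (by omega), hZi, Finset.card_singleton] at h1
        obtain ⟨i', hi'⟩ := Finset.card_eq_one.1 (by omega : W.card = 1)
        exact ⟨i', by rw [← hZi, ← hi', hZW]⟩
  have hπ : ∀ i, ∃ i', P {i} = P' {i'} := by
    intro i
    obtain ⟨j, hj⟩ := exists_ne i
    obtain ⟨X, Y, hX, hY, hXY, hiX, -⟩ := hsep i j hj.symm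
    exact key _ i X Y rfl hiX hX.le hY.le hXY
  choose π hπ using hπ
  have hinj : Function.Injective π := by
    intro i j hij
    by_contra hne
    have h1 : P {i, j} = P {i} := by
      rw [Finset.insert_eq, hP.union, hπ i, hπ j, hij, sup_idem]
    have h2 := hP.rank {i, j} (by rw [Finset.card_pair hne]; omega)
    rw [h1, hP.rank {i} (by rw [Finset.card_singleton]; omega), Finset.card_pair hne] at h2
    simp at h2
  refine ⟨X.image π, by rw [Finset.card_image_of_injective _ hinj, hX], ?_⟩
  have hne : X.Nonempty := Finset.card_pos.1 (by omega)
  clear hX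
  induction hne using Finset.Nonempty.cons_induction with
  | singleton a => simpa using hπ a
  | cons a X ha hX ih =>
    rw [Finset.cons_eq_insert, Finset.image_insert, Finset.insert_eq, Finset.insert_eq, hP.union,
      hP'.union, ih, hπ]

/-- A frame and a frame of the dual lattice define a family of small blocks of indices: the block
of `j` consists of the points of the first frame on the `j`-th hyperplane of the second. -/
theorem exists_blocks [Fintype ι] (h : IsRank r) {c : ℤ} (hP : IsFrame r (2 * k) (c - k) P)
    {H : Finset ι → Lᵒᵈ}
    (hH : IsFrame (fun x : Lᵒᵈ => -r (OrderDual.ofDual x)) (2 * k) (-c - k) H) (hk : 1 ≤ k) :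
    ∃ D : ι → Finset ι, (∀ j, (D j).card ≤ 2 * k - 1) ∧
      (∀ X : Finset ι, X.card = k → (Finset.univ.filter fun j => X ⊆ D j).card ≤ k) ∧
      ∀ X Y : Finset ι, X.card = k → Y.card = k → P X = OrderDual.ofDual (H Y) →
        k ≤ (Finset.univ.filter fun j => X ⊆ D j).card := by
  classical
  refine ⟨fun j => Finset.univ.filter fun i => P {i} ≤ OrderDual.ofDual (H {j}),
    fun j => ?_, fun X hX => ?_, fun X Y hX hY hXY => ?_⟩
  -- The join of `2 * k` points has rank `c + k`, while a hyperplane of the dual frame has rank `c +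
  -- k - 1`.
  · by_contra hlt
    push Not at hlt
    have hlt' := Nat.succ_le_of_lt hlt
    rw [Nat.succ_eq_add_one, show 2 * k - 1 + 1 = 2 * k by omega] at hlt'
    obtain ⟨E, hE, hEc⟩ := Finset.exists_subset_card_eq hlt'
    have h1 : P E ≤ OrderDual.ofDual (H {j}) :=
      (hP.le_iff (Finset.card_pos.1 (by rw [hEc]; omega))).2
        fun i hi => (Finset.mem_filter.1 (hE hi)).2
    have h2 := h.strictMono.monotone h1
    have h3 := hH.rank {j} (by rw [Finset.card_singleton]; omega)
    rw [hP.rank E hEc.le, hEc] at h2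
    rw [Finset.card_singleton] at h3
    push_cast at h2 h3
    omega
  -- The meet of `k + 1` hyperplanes has rank `c - 1`, too small to contain `P X`.
  · by_contra hlt
    push Not at hlt
    obtain ⟨E, hE, hEc⟩ := Finset.exists_subset_card_eq (Nat.succ_le_of_lt hlt)
    have hE1 : P X ≤ OrderDual.ofDual (H E) := by
      refine (hH.le_iff (y := OrderDual.toDual (P X)) (Finset.card_pos.1 (by omega))).2
        fun j hj => ?_
      refine (hP.le_iff (y := OrderDual.ofDual (H {j})) (Finset.card_pos.1 (by omega))).2
        fun i hi => ?_
      exact (Finset.mem_filter.1 ((Finset.mem_filter.1 (hE hj)).2 hi)).2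
    have h2 := h.strictMono.monotone hE1
    have h3 := hH.rank E (by omega)
    rw [hP.rank X (by omega), hX] at h2
    rw [hEc] at h3
    push_cast at h2 h3
    omega
  · rw [← hY]
    refine Finset.card_le_card fun j hj => ?_
    simp only [Finset.mem_filter, Finset.mem_univ, true_and]
    intro i hi
    simp only [Finset.mem_filter, Finset.mem_univ, true_and]
    have h1 : H {j} ≤ H Y := hH.mono (Finset.singleton_subset_iff.2 hj)
    exact ((hP.mono (Finset.singleton_subset_iff.2 hi)).trans hXY.le).trans h1

end IsFrame

end Frame

/-! ### Counting blocks -/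

section Blocks

/-- This contradicts the block count in the mixed case. Induction on `n` by Pascal's rule starts at
`2 * k + 1`, or at 6 for `k = 2`; at `n = 5`, `k = 2` the inequality fails (21 against 20). -/
theorem mul_choose_lt {n k : ℕ} (hk : 2 ≤ k) (hn : 2 * k + 1 ≤ n) (h52 : ¬ (n = 5 ∧ k = 2)) :
    n * (2 * k - 1).choose k + k * (n - 2).choose (k - 1) < k * n.choose k := by
  obtain ⟨j, rfl⟩ := Nat.exists_eq_add_of_le' hk
  have ha : (2 * j + 3).choose (j + 1) = (2 * j + 3).choose (j + 2) :=
    Nat.choose_symm_of_eq_add (by ring)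
  have step : ∀ n, 2 * (j + 2) + 1 ≤ n →
      n * (2 * (j + 2) - 1).choose (j + 2) + (j + 2) * (n - 2).choose (j + 2 - 1) <
        (j + 2) * n.choose (j + 2) →
      (n + 1) * (2 * (j + 2) - 1).choose (j + 2) + (j + 2) * (n + 1 - 2).choose (j + 2 - 1) <
        (j + 2) * (n + 1).choose (j + 2) := by
    intro n hn ih
    obtain ⟨p, rfl⟩ := Nat.exists_eq_add_of_le' (show 2 ≤ n by omega)
    simp only [show 2 * (j + 2) - 1 = 2 * j + 3 by omega, show j + 2 - 1 = j + 1 by omega,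
      show p + 2 - 2 = p by omega, show p + 2 + 1 - 2 = p + 1 by omega] at ih ⊢
    have h1 : (p + 1).choose (j + 1) = p.choose j + p.choose (j + 1) := Nat.choose_succ_succ _ _
    have h2 : (p + 2 + 1).choose (j + 2) = (p + 2).choose (j + 1) + (p + 2).choose (j + 2) :=
      Nat.choose_succ_succ _ _
    have h3 : (p + 2).choose (j + 1) = (p + 1).choose j + (p + 1).choose (j + 1) :=
      Nat.choose_succ_succ _ _
    have h4 : p.choose j ≤ (p + 1).choose j := Nat.choose_le_choose _ (by omega)
    have h5 : (2 * j + 3).choose (j + 1) ≤ (p + 1).choose (j + 1) :=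
      Nat.choose_le_choose _ (by omega)
    rw [h1, h2, h3]
    rw [ha] at h5
    nlinarith
  rcases Nat.eq_zero_or_pos j with rfl | hj
  · have h6 : 6 ≤ n := by omega
    induction n, h6 using Nat.le_induction with
    | base => decide
    | succ n hn6 ih => exact step n (by omega) (ih (by omega) (by omega))
  · induction n, hn using Nat.le_induction with
    | base =>
      have hq := Nat.choose_succ_right_eq (2 * j + 3) j
      have e1 : (2 * j + 3 + 1 + 1).choose (j + 2) =
          (2 * j + 3 + 1).choose (j + 1) + (2 * j + 3 + 1).choose (j + 2) :=
        Nat.choose_succ_succ _ _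
      have e2 : (2 * j + 3 + 1).choose (j + 1) = (2 * j + 3).choose j + (2 * j + 3).choose (j + 1) :=
        Nat.choose_succ_succ _ _
      have e3 : (2 * j + 3 + 1).choose (j + 2) =
          (2 * j + 3).choose (j + 1) + (2 * j + 3).choose (j + 2) := Nat.choose_succ_succ _ _
      rw [show 2 * (j + 2) - 1 = 2 * j + 3 by omega, show j + 2 - 1 = j + 1 by omega,
        show 2 * (j + 2) + 1 - 2 = 2 * j + 3 by omega,
        show 2 * (j + 2) + 1 = 2 * j + 3 + 1 + 1 by omega, e1, e2, e3, ← ha]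
      rw [show 2 * j + 3 - j = j + 3 by omega] at hq
      set a := (2 * j + 3).choose (j + 1)
      set q := (2 * j + 3).choose j
      have hapos : 0 < a := Nat.choose_pos (by omega)
      obtain ⟨i, rfl⟩ := Nat.exists_eq_add_of_le' hj
      -- At `n = 2 * k + 1` the claim reduces to `a < k * q`, and `(k - 1) * a = (k + 1) * q`. Here
      -- `k = i + 3`.
      have h1 : (i + 4) * a < (i + 4) * ((i + 3) * q) := by
        have h0 : (i + 4) * ((i + 3) * q) = (i + 3) * (i + 2) * a := by
          have hq' : a * (i + 2) = q * (i + 4) := hq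
          calc (i + 4) * ((i + 3) * q) = (i + 3) * (q * (i + 4)) := by ring
            _ = (i + 3) * (i + 2) * a := by rw [← hq']; ring
        rw [h0]
        exact Nat.mul_lt_mul_of_pos_right (by nlinarith) hapos
      have h2 := Nat.lt_of_mul_lt_mul_left h1
      nlinarith
    | succ n hn ih => exact step n hn (ih (by omega))

variable {ι : Type*} [DecidableEq ι] [Fintype ι] {k : ℕ} {D : ι → Finset ι}
  {T : Finset (Finset ι)}

theorem sum_card_filter_subset (D : ι → Finset ι) (k : ℕ) :
    ∑ X ∈ Finset.univ.powersetCard k, (Finset.univ.filter fun j => X ⊆ D j).card =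
      ∑ j, (D j).card.choose k := by
  simp_rw [Finset.card_filter]
  rw [Finset.sum_comm]
  refine Finset.sum_congr rfl fun j _ => ?_
  rw [← Finset.card_filter, ← Finset.card_powersetCard]
  congr 1
  ext X
  simp only [Finset.mem_filter, Finset.mem_powersetCard, Finset.subset_univ, true_and]
  tauto

theorem mul_card_le_of_blocks (hT : ∀ X ∈ T, X.card = k)
    (hD : ∀ j, (D j).card ≤ 2 * k - 1)
    (hDT : ∀ X ∈ T, k ≤ (Finset.univ.filter fun j => X ⊆ D j).card) :
    k * T.card ≤ Fintype.card ι * (2 * k - 1).choose k := by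
  calc k * T.card = ∑ X ∈ T, k := by rw [Finset.sum_const, smul_eq_mul, mul_comm]
    _ ≤ ∑ X ∈ T, (Finset.univ.filter fun j => X ⊆ D j).card := Finset.sum_le_sum hDT
    _ ≤ ∑ X ∈ Finset.univ.powersetCard k, (Finset.univ.filter fun j => X ⊆ D j).card :=
      Finset.sum_le_sum_of_subset fun X hX => Finset.mem_powersetCard_univ.2 (hT X hX)
    _ = ∑ j, (D j).card.choose k := sum_card_filter_subset D k
    _ ≤ ∑ _j : ι, (2 * k - 1).choose k :=
      Finset.sum_le_sum fun j _ => Nat.choose_le_choose _ (hD j)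
    _ = _ := by rw [Finset.sum_const, smul_eq_mul, Finset.card_univ]

/-- Five triples of a five-element set cannot cover exactly seven pairs twice. -/
theorem false_of_blocks_five (hι : Fintype.card ι = 5) (hT : ∀ X ∈ T, X.card = 2)
    (hD : ∀ j, (D j).card ≤ 3)
    (hD2 : ∀ X : Finset ι, X.card = 2 → (Finset.univ.filter fun j => X ⊆ D j).card ≤ 2)
    (hDT : ∀ X ∈ T, 2 ≤ (Finset.univ.filter fun j => X ⊆ D j).card) (hTc : T.card = 7) :
    False := by
  set c : Finset ι → ℕ := fun X => (Finset.univ.filter fun j => X ⊆ D j).card with hc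
  have hTs : T ⊆ Finset.univ.powersetCard 2 := fun X hX => Finset.mem_powersetCard_univ.2 (hT X hX)
  have hsum : ∑ X ∈ Finset.univ.powersetCard 2, c X = ∑ j, (D j).card.choose 2 :=
    sum_card_filter_subset D 2
  have hT14 : ∑ X ∈ T, c X = 14 := by
    rw [Finset.sum_congr rfl fun X hX => le_antisymm (hD2 X (hT X hX)) (hDT X hX),
      Finset.sum_const, hTc]
    rfl
  have hsplit := Finset.sum_sdiff (f := c) hTs
  have hle3 : ∀ j, (D j).card.choose 2 ≤ 3 := fun j => Nat.choose_le_choose 2 (hD j)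
  -- The seven pairs use 14 incidences, and a block with fewer than three points would leave at most
  -- 13. So the total is 15, and exactly one other pair is covered, once.
  have hall : ∀ j, (D j).card = 3 := by
    intro j
    by_contra hne
    have h1 : (D j).card.choose 2 ≤ 1 :=
      Nat.choose_le_choose (b := 2) 2 (by have := hD j; omega)
    have h2 : ∑ i ∈ Finset.univ.erase j, (D i).card.choose 2 ≤ 12 := by
      refine (Finset.sum_le_card_nsmul _ _ 3 fun i _ => hle3 i).trans ?_
      rw [Finset.card_erase_of_mem (Finset.mem_univ j), Finset.card_univ, hι]
      norm_num
    have h3 := Finset.add_sum_erase Finset.univ (fun i => (D i).card.choose 2) (Finset.mem_univ j)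
    omega
  have h15 : ∑ j, (D j).card.choose 2 = 15 := by
    rw [Finset.sum_congr rfl fun j _ => by rw [hall j], Finset.sum_const, Finset.card_univ, hι]
    rfl
  have h1 : ∑ X ∈ Finset.univ.powersetCard 2 \ T, c X = 1 := by omega
  obtain ⟨X₀, hX₀, hX₀c⟩ : ∃ X ∈ Finset.univ.powersetCard 2 \ T, c X ≠ 0 :=
    Finset.exists_ne_zero_of_sum_ne_zero (by omega)
  have h2 := Finset.add_sum_erase _ c hX₀
  have hX₀1 : c X₀ = 1 := by omega
  have hzero : ∀ X ∈ (Finset.univ.powersetCard 2 \ T).erase X₀, c X = 0 :=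
    Finset.sum_eq_zero_iff.1 (by omega)
  have heven : ∀ X : Finset ι, X.card = 2 → X ≠ X₀ → Even (c X) := by
    intro X hX hne
    by_cases hXT : X ∈ T
    · rw [show c X = 2 from le_antisymm (hD2 X hX) (hDT X hXT)]
      exact even_two
    · rw [hzero X (Finset.mem_erase.2 ⟨hne, Finset.mem_sdiff.2
        ⟨Finset.mem_powersetCard_univ.2 hX, hXT⟩⟩)]
      exact Even.zero
  obtain ⟨a, b, hab, rfl⟩ := Finset.card_eq_two.1
    (Finset.mem_powersetCard_univ.1 (Finset.mem_sdiff.1 hX₀).1)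
  -- Each triple through `a` covers two pairs at `a`, so the sum is even; the pair covered once
  -- makes it odd.
  have hrow : ∑ x ∈ Finset.univ.erase a, c {a, x} = ∑ j, if a ∈ D j then 2 else 0 := by
    simp only [hc, Finset.card_filter]
    rw [Finset.sum_comm]
    refine Finset.sum_congr rfl fun j _ => ?_
    split_ifs with haj
    · have : (D j).erase a = (Finset.univ.erase a).filter fun x => ({a, x} : Finset ι) ⊆ D j := by
        ext x
        simp [Finset.insert_subset_iff, haj]
      rw [← Finset.card_filter, ← this, Finset.card_erase_of_mem haj, hall]
    · refine Finset.sum_eq_zero fun x _ => if_neg fun hs => haj (hs (by simp))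
  have hodd : ¬ Even (∑ x ∈ Finset.univ.erase a, c {a, x}) := by
    rw [← Finset.add_sum_erase _ _ (Finset.mem_erase.2 ⟨hab.symm, Finset.mem_univ b⟩), hX₀1,
      Nat.even_add]
    have : Even (∑ x ∈ (Finset.univ.erase a).erase b, c {a, x}) := by
      refine Finset.even_sum _ fun x hx => ?_
      simp only [Finset.mem_erase, Finset.mem_univ, and_true] at hx
      refine heven _ (Finset.card_pair (Ne.symm hx.2)) fun he => ?_
      have : x ∈ ({a, b} : Finset ι) := he ▸ by simp
      simp only [Finset.mem_insert, Finset.mem_singleton] at this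
      tauto
    simp [this]
  refine hodd (hrow ▸ Finset.even_sum _ fun j _ => ?_)
  split_ifs
  · exact even_two
  · exact Even.zero

theorem card_filter_mem_notMem (k : ℕ) {i j : ι} (hij : i ≠ j) :
    ((Finset.univ.powersetCard (k + 1)).filter fun X : Finset ι => i ∈ X ∧ j ∉ X).card =
      (Fintype.card ι - 2).choose k := by
  have hc : ((Finset.univ.erase i).erase j).card = Fintype.card ι - 2 := by
    rw [Finset.card_erase_of_mem (Finset.mem_erase.2 ⟨hij.symm, Finset.mem_univ j⟩),
      Finset.card_erase_of_mem (Finset.mem_univ i), Finset.card_univ]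
    omega
  rw [← hc, ← Finset.card_powersetCard]
  refine Finset.card_bij' (fun X _ => X.erase i) (fun X _ => insert i X) ?_ ?_ ?_ ?_
  · intro X hX
    simp only [Finset.mem_filter, Finset.mem_powersetCard_univ] at hX
    rw [Finset.mem_powersetCard, Finset.card_erase_of_mem hX.2.1]
    refine ⟨fun x hx => ?_, by omega⟩
    grind
  · intro X hX
    rw [Finset.mem_powersetCard] at hX
    have hi : i ∉ X := fun h => by simpa using hX.1 h
    have hj : j ∉ X := fun h => by simpa using hX.1 h
    simp only [Finset.mem_filter, Finset.mem_powersetCard_univ]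
    rw [Finset.card_insert_of_notMem hi]
    grind
  · intro X hX
    exact Finset.insert_erase (Finset.mem_filter.1 hX).2.1
  · intro X hX
    rw [Finset.mem_powersetCard] at hX
    exact Finset.erase_insert fun h => by simpa using hX.1 h

end Blocks

/-! ### The vertices missed by a second embedding -/

section Inexact

theorem IsJohnsonEmbedding.compl {ι L : Type*} [DecidableEq ι] [Fintype ι] [Lattice L] {r : L → ℤ}
    {k l : ℕ} {c : ℤ} {g : Finset ι → L} (hg : IsJohnsonEmbedding r k c g)
    (hl : l + k = Fintype.card ι) : IsJohnsonEmbedding r l c (fun X => g Xᶜ) := by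
  intro X Y hX hY
  have h1 := hg Xᶜ Yᶜ (by rw [Finset.card_compl]; omega) (by rw [Finset.card_compl]; omega)
  have h2 : Xᶜ \ Yᶜ = Y \ X := by ext; grind [Finset.mem_compl]
  rw [h1, h2, Finset.card_sdiff_comm (by omega)]

variable {ι L : Type*} [DecidableEq ι] [Fintype ι] [Lattice L] [BoundedOrder L] {r : L → ℤ}
  {k : ℕ} {c : ℤ} {g g' : Finset ι → L}

/-- The mixed case: a star-preserving embedding and one that sends stars into tops cannot have
many common vertices. -/
theorem false_of_mixed (h : IsRank r) (hk : 2 ≤ k) (hn : 2 * k + 1 ≤ Fintype.card ι)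
    (hg : IsJohnsonEmbedding r k c g) (hg' : IsJohnsonEmbedding r k c g')
    (hs : IsStarPreserving k g) (hs' : IsStarPreserving k (fun X => OrderDual.toDual (g' X)))
    {T : Finset (Finset ι)}
    (hT : ∀ X ∈ T, X.card = k ∧ ∃ Y : Finset ι, Y.card = k ∧ g' Y = g X)
    (hTc : T.card + (Fintype.card ι - 2).choose (k - 1) = (Fintype.card ι).choose k) : False := by
  obtain ⟨P, hP, hgP⟩ := hg.exists_isFrame h (by omega) hs (by omega)
  obtain ⟨H, hH, hgH⟩ := (hg'.dual h).exists_isFrame h.dual (by omega) hs' (by omega)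
  obtain ⟨D, hD1, hD2, hD3⟩ := hP.exists_blocks h hH (by omega)
  have hDT : ∀ X ∈ T, k ≤ (Finset.univ.filter fun j => X ⊆ D j).card := by
    intro X hX
    obtain ⟨hXc, Y, hY, hXY⟩ := hT X hX
    refine hD3 X Y hXc hY ?_
    rw [← hgP X hXc, ← hgH Y hY, hXY]
    rfl
  by_cases h52 : Fintype.card ι = 5 ∧ k = 2
  · obtain ⟨h5, rfl⟩ := h52
    refine false_of_blocks_five h5 (fun X hX => (hT X hX).1) hD1 hD2 hDT ?_
    rw [h5] at hTc
    have h1 : Nat.choose (5 - 2) (2 - 1) = 3 := rfl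
    have h2 : Nat.choose 5 2 = 10 := rfl
    omega
  · have h1 := mul_choose_lt hk hn h52
    have h2 := mul_card_le_of_blocks (fun X hX => (hT X hX).1) hD1 hDT
    rw [← hTc, mul_add] at h1
    omega

theorem exists_eq_filter_of_star (h : IsRank r) (hk : 2 ≤ k) (hn : 2 * k ≤ Fintype.card ι)
    (hg : IsJohnsonEmbedding r k c g) (hg' : IsJohnsonEmbedding r k c g')
    (hs : IsStarPreserving k g) {N : Finset (Finset ι)}
    (hN : ∀ X, X ∈ N ↔ X.card = k ∧ ¬ ∃ Y : Finset ι, Y.card = k ∧ g' Y = g X)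
    (hNc : N.card = (Fintype.card ι - 2).choose (k - 1)) :
    ∃ i j : ι, i ≠ j ∧ ∀ X : Finset ι, X.card = k → (X ∈ N ↔ i ∈ X ∧ j ∉ X) := by
  wlog hs' : IsStarPreserving k g' generalizing g'
  · have hs'' := (hg'.isStarPreserving_or_dual h hk (by omega)).resolve_left hs'
    rcases hn.eq_or_lt with hn2 | hn2
    · refine this (g' := fun X => g' Xᶜ) (hg'.compl (by omega)) (fun X => ?_) ?_
      · rw [hN]
        refine and_congr_right fun _ => not_congr ?_
        constructor
        · rintro ⟨Y, hY, hXY⟩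
          exact ⟨Yᶜ, by rw [Finset.card_compl]; omega, by rwa [compl_compl]⟩
        · rintro ⟨Y, hY, hXY⟩
          exact ⟨Yᶜ, by rw [Finset.card_compl]; omega, hXY⟩
      -- For `n = 2 * k`, complementation is an automorphism of J(n,k) exchanging stars and tops:
      -- the complements of `Z + a` and `Z + b` together cover that of `Z + d`.
      · obtain ⟨H, hH, hgH⟩ := (hg'.dual h).exists_isFrame h.dual (by omega) hs'' (by omega)
        have hgH' : ∀ X : Finset ι, X.card = k → g' X = OrderDual.ofDual (H X) := fun X hX => by
          rw [← hgH X hX]; rfl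
        intro Z a b d hZ ha hb hd hab had hbd
        have card : ∀ u, u ∉ Z → (insert u Z)ᶜ.card = k := by
          intro u hu
          rw [Finset.card_compl, Finset.card_insert_of_notMem hu]
          omega
        have hcov : (insert d Z)ᶜ ⊆ (insert a Z)ᶜ ∪ (insert b Z)ᶜ := by
          intro x; simp only [Finset.mem_compl, Finset.mem_union, Finset.mem_insert]; grind
        have h1 := hH.mono hcov
        rw [hH.union] at h1
        simp only
        rw [hgH' _ (card a ha), hgH' _ (card b hb), hgH' _ (card d hd)]
        exact h1
    · exfalso
      refine false_of_mixed h hk hn2 hg hg' hs hs'' (T := Finset.univ.powersetCard k \ N) ?_ ?_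
      · intro X hX
        rw [Finset.mem_sdiff, hN, Finset.mem_powersetCard_univ] at hX
        exact ⟨hX.1, not_not.1 fun h => hX.2 ⟨hX.1, h⟩⟩
      · rw [← hNc, Finset.card_sdiff_add_card_eq_card, Finset.card_powersetCard, Finset.card_univ]
        exact fun X hX => Finset.mem_powersetCard_univ.2 ((hN X).1 hX).1
  obtain ⟨P, hP, hgP⟩ := hg.exists_isFrame h (by omega) hs (by omega)
  obtain ⟨P', hP', hgP'⟩ := hg'.exists_isFrame h (by omega) hs' (by omega)
  have : Nontrivial ι := Fintype.one_lt_card_iff_nontrivial.1 (by omega)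
  by_cases hsep : ∀ i j : ι, i ≠ j → ∃ X Y : Finset ι, X.card = k ∧ Y.card = k ∧ P X = P' Y ∧
      i ∈ X ∧ j ∉ X
  · exfalso
    have h1 : 0 < N.card := by rw [hNc]; exact Nat.choose_pos (by omega)
    obtain ⟨X, hX⟩ := Finset.card_pos.1 h1
    obtain ⟨hXc, hX⟩ := (hN X).1 hX
    obtain ⟨Y, hY, hXY⟩ := hP.exists_eq_of_separating h hP' (by omega) hsep X hXc
    exact hX ⟨Y, hY, by rw [hgP X hXc, hgP' Y hY, hXY]⟩
  · push Not at hsep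
    obtain ⟨i, j, hij, hsep⟩ := hsep
    refine ⟨i, j, hij, ?_⟩
    have hsub : ((Finset.univ.powersetCard k).filter fun X : Finset ι => i ∈ X ∧ j ∉ X) ⊆ N := by
      intro X hX
      simp only [Finset.mem_filter, Finset.mem_powersetCard_univ] at hX
      rw [hN]
      refine ⟨hX.1, fun ⟨Y, hY, hXY⟩ => hX.2.2 (hsep X Y hX.1 hY ?_ hX.2.1)⟩
      rw [← hgP X hX.1, ← hgP' Y hY, hXY]
    have heq := Finset.eq_of_subset_of_card_le hsub (by
      obtain ⟨l, rfl⟩ := Nat.exists_eq_add_of_le' (show 1 ≤ k by omega)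
      rw [hNc, card_filter_mem_notMem l hij]
      rfl)
    intro X hX
    rw [← heq]
    simp [hX]

/-- If an embedding `g'` of `J(n,k)` misses exactly `(n-2).choose (k-1)` vertices of an embedding
`g`, then they correspond to the sets that contain `i` and do not contain `j`. -/
theorem exists_eq_filter (h : IsRank r) (hk : 2 ≤ k) (hn : k + 2 ≤ Fintype.card ι)
    (hg : IsJohnsonEmbedding r k c g) (hg' : IsJohnsonEmbedding r k c g')
    {N : Finset (Finset ι)}
    (hN : ∀ X, X ∈ N ↔ X.card = k ∧ ¬ ∃ Y : Finset ι, Y.card = k ∧ g' Y = g X)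
    (hNc : N.card = (Fintype.card ι - 2).choose (k - 1)) :
    ∃ i j : ι, i ≠ j ∧ ∀ X : Finset ι, X.card = k → (X ∈ N ↔ i ∈ X ∧ j ∉ X) := by
  wlog hkn : 2 * k ≤ Fintype.card ι generalizing k g g' N
  · obtain ⟨l, hl⟩ := Nat.exists_eq_add_of_le (show k ≤ Fintype.card ι by omega)
    obtain ⟨i, j, hij, hX⟩ := this (k := l) (by omega) (by omega) (hg.compl (by omega))
      (hg'.compl (by omega)) (N := N.map ⟨compl, compl_injective⟩) (fun X => by
        simp only [Finset.mem_map, Function.Embedding.coeFn_mk, hN]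
        constructor
        · rintro ⟨X, ⟨hX, hne⟩, rfl⟩
          rw [Finset.card_compl, compl_compl]
          refine ⟨by omega, fun ⟨Y, hY, hXY⟩ => hne ⟨Yᶜ, ?_, hXY⟩⟩
          rw [Finset.card_compl]; omega
        · rintro ⟨hX, hne⟩
          refine ⟨Xᶜ, ⟨by rw [Finset.card_compl]; omega, fun ⟨Y, hY, hXY⟩ =>
            hne ⟨Yᶜ, ?_, by rwa [compl_compl]⟩⟩, compl_compl X⟩
          rw [Finset.card_compl]; omega)
      (by
        rw [Finset.card_map, hNc]
        exact Nat.choose_symm_of_eq_add (by omega)) (by omega)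
    refine ⟨j, i, hij.symm, fun X hXc => ?_⟩
    have h1 := hX Xᶜ (by rw [Finset.card_compl]; omega)
    simp only [Finset.mem_map, Function.Embedding.coeFn_mk, Finset.mem_compl, not_not,
      compl_inj_iff, exists_eq_right] at h1
    rw [h1, and_comm]
  · rcases hg.isStarPreserving_or_dual h hk hn with hs | hs
    · exact exists_eq_filter_of_star h hk hkn hg hg' hs hN hNc
    · exact exists_eq_filter_of_star h.dual hk hkn (hg.dual h) (hg'.dual h) hs hN hNc

end Inexact

/-! ### Graph distances -/

section Distance

/-- A function on pairs of vertices which changes by at most one along every edge, and can be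
decreased along some edge, is the distance of the graph. -/
theorem dist_eq_of_step {α : Type*} {G : SimpleGraph α} {δ : α → α → ℕ} (h0 : ∀ x, δ x x = 0)
    (hadj : ∀ x y z, G.Adj x y → δ x z ≤ δ y z + 1)
    (hstep : ∀ x z, x ≠ z → ∃ y, G.Adj x y ∧ δ y z + 1 = δ x z) (x z : α) :
    G.dist x z = δ x z := by
  have hlow : ∀ {x z : α} (w : G.Walk x z), δ x z ≤ w.length := by
    intro x z w
    induction w with
    | nil => exact (h0 _).le
    | cons hxy w ih => exact (hadj _ _ _ hxy).trans (Nat.succ_le_succ ih)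
  have hwalk : ∀ (m : ℕ) (x : α), δ x z = m → ∃ w : G.Walk x z, w.length = m := by
    intro m
    induction m with
    | zero =>
      intro x hx
      by_cases hxz : x = z
      · subst hxz
        exact ⟨SimpleGraph.Walk.nil, rfl⟩
      · obtain ⟨y, -, hy⟩ := hstep x z hxz
        omega
    | succ m ih =>
      intro x hx
      obtain ⟨y, hxy, hy⟩ := hstep x z fun h => by
        subst h
        rw [h0] at hx
        omega
      obtain ⟨w, hw⟩ := ih y (by omega)
      exact ⟨SimpleGraph.Walk.cons hxy w, by rw [SimpleGraph.Walk.length_cons, hw]⟩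
  obtain ⟨w, hw⟩ := hwalk _ x rfl
  obtain ⟨w', hw'⟩ := w.reachable.exists_walk_length_eq_dist
  exact le_antisymm (hw ▸ SimpleGraph.dist_le w) (hw' ▸ hlow w')

theorem exists_johnsonGraph_adj {n k : ℕ} {X Z : {X : Finset (Fin n) // X.card = k}}
    (hXZ : X ≠ Z) :
    ∃ Y, (johnsonGraph n k).Adj X Y ∧ (Y.1 \ Z.1).card + 1 = (X.1 \ Z.1).card := by
  have hne : (X.1 \ Z.1).Nonempty := by
    by_contra h
    rw [Finset.not_nonempty_iff_eq_empty, Finset.sdiff_eq_empty_iff_subset] at h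
    exact hXZ (Subtype.ext (Finset.eq_of_subset_of_card_le h (by rw [X.2, Z.2])))
  have hne' : (Z.1 \ X.1).Nonempty := by
    rw [← Finset.card_pos, Finset.card_sdiff_comm (by rw [X.2, Z.2])]
    exact Finset.card_pos.2 hne
  obtain ⟨x, hx⟩ := hne
  obtain ⟨z, hz⟩ := hne'
  have hc := Finset.card_erase_add_one hx
  rw [Finset.mem_sdiff] at hx hz
  have hX := Finset.card_erase_add_one hx.1
  have hzX : z ∉ X.1.erase x := fun h => hz.2 (Finset.mem_of_mem_erase h)
  refine ⟨⟨insert z (X.1.erase x), by rw [Finset.card_insert_of_notMem hzX, hX, X.2]⟩,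
    ⟨fun h => ?_, ?_⟩, ?_⟩
  · exact hz.2 (by rw [h]; exact Finset.mem_insert_self _ _)
  · have : X.1 ∩ insert z (X.1.erase x) = X.1.erase x := by ext; grind
    rw [this, hX, X.2]
  · have : insert z (X.1.erase x) \ Z.1 = (X.1 \ Z.1).erase x := by ext; grind
    rw [this, hc]

theorem johnsonGraph_dist {n k : ℕ} (X Y : {X : Finset (Fin n) // X.card = k}) :
    (johnsonGraph n k).dist X Y = (X.1 \ Y.1).card := by
  refine dist_eq_of_step (δ := fun X Y => (X.1 \ Y.1).card) (fun X => by simp) ?_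
    (fun X Z h => exists_johnsonGraph_adj h) X Y
  intro X Y Z hXY
  have h1 : X.1 \ Z.1 ⊆ (X.1 \ Y.1) ∪ (Y.1 \ Z.1) := by intro x; grind
  have h2 := (Finset.card_le_card h1).trans (Finset.card_union_le _ _)
  have h3 := Finset.card_sdiff_add_card_inter X.1 Y.1
  have h4 := hXY.2
  have h5 := X.2
  omega

end Distance

/-! ### Apartments and transvections -/

section Apartment

variable {R V : Type*} [DivisionRing R] [AddCommGroup V] [Module R V]

theorem isRank_finrank [FiniteDimensional R V] :
    IsRank (fun S : Submodule R V => (Module.finrank R S : ℤ)) where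
  strictMono := fun _ _ h => Int.ofNat_lt.2 (Submodule.finrank_lt_finrank_of_lt h)
  sup_add_inf := fun S U => by exact_mod_cast Submodule.finrank_sup_add_finrank_inf_eq S U

/-- The subspace spanned by the base vectors with indices in `X`. -/
def coordSpan {ι : Type*} (b : Module.Basis ι R V) (X : Finset ι) : Submodule R V :=
  Submodule.span R (b '' X)

variable {ι : Type*} (b : Module.Basis ι R V)

theorem basis_mem_coordSpan_iff {i : ι} {X : Finset ι} : b i ∈ coordSpan b X ↔ i ∈ X := by
  rw [coordSpan, b.mem_span_image, b.repr_self, Finsupp.support_single _ one_ne_zero]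
  simp

theorem coordSpan_union [DecidableEq ι] (X Y : Finset ι) :
    coordSpan b (X ∪ Y) = coordSpan b X ⊔ coordSpan b Y := by
  rw [coordSpan, Finset.coe_union, Set.image_union, Submodule.span_union]
  rfl

theorem finrank_coordSpan (X : Finset ι) : Module.finrank R (coordSpan b X) = X.card := by
  classical
  have h1 : LinearIndepOn R id ((X.image b : Finset V) : Set V) := by
    refine b.linearIndependent.linearIndepOn_id.mono ?_
    rw [Finset.coe_image]
    exact Set.image_subset_range _ _
  have h2 := finrank_span_finset_eq_card h1
  rwa [Finset.coe_image, Finset.card_image_of_injective _ b.injective] at h2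

theorem finrank_coordSpan_inf [DecidableEq ι] [FiniteDimensional R V] (X Y : Finset ι) :
    Module.finrank R (coordSpan b X ⊓ coordSpan b Y : Submodule R V) = (X ∩ Y).card := by
  have h1 := Submodule.finrank_sup_add_finrank_inf_eq (coordSpan b X) (coordSpan b Y)
  rw [← coordSpan_union, finrank_coordSpan, finrank_coordSpan, finrank_coordSpan] at h1
  have := Finset.card_union_add_card_inter X Y
  omega

/-- The element of the apartment of `b` that corresponds to a `k`-element set of indices. -/
def apartmentMap {k : ℕ} (X : {X : Finset ι // X.card = k}) : Grassmannian R V k :=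
  ⟨coordSpan b X.1, by rw [finrank_coordSpan, X.2]⟩

theorem apartment_eq_range [Finite ι] (k : ℕ) :
    apartment b k = Set.range (apartmentMap b (k := k)) := by
  ext P
  constructor
  · rintro ⟨X, hX, hP⟩
    obtain ⟨s, rfl⟩ := Set.subset_range_iff_exists_image_eq.1 hX
    have hs : P.1 = coordSpan b (Set.toFinite s).toFinset := by
      rw [hP, coordSpan, Set.Finite.coe_toFinset]
    exact ⟨⟨(Set.toFinite s).toFinset, by rw [← finrank_coordSpan b, ← hs, P.2]⟩,
      Subtype.ext hs.symm⟩
  · rintro ⟨X, rfl⟩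
    exact ⟨b '' X.1, Set.image_subset_range _ _, rfl⟩

/-- Any two subspaces are spanned by subsets of a common base. -/
theorem exists_basis_coordSpan [FiniteDimensional R V] (P Q : Submodule R V) :
    ∃ (b : Module.Basis (Fin (Module.finrank R V)) R V) (X Y : Finset (Fin (Module.finrank R V))),
      P = coordSpan b X ∧ Q = coordSpan b Y := by
  classical
  obtain ⟨B₀, hB₀, hsp₀, hli₀⟩ := exists_linearIndependent R ((P ⊓ Q : Submodule R V) : Set V)
  obtain ⟨B₁, hB₁, hB₀₁, hsp₁, hli₁⟩ :=
    exists_linearIndepOn_id_extension (K := R) (t := (P : Set V)) hli₀ fun x hx => (hB₀ hx).1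
  -- `B₀` spans `P ⊓ Q`, `B₁` extends it to `P`, and `B₂` extends it to `Q` inside a complement `D`,
  -- so `B₁ ∪ B₂` is independent.
  obtain ⟨D, hD⟩ := Submodule.exists_isCompl (P ⊓ Q)
  obtain ⟨B₂, hB₂, hsp₂, hli₂⟩ := exists_linearIndependent R ((D ⊓ Q : Submodule R V) : Set V)
  rw [Submodule.span_eq] at hsp₀ hsp₂
  have hP : Submodule.span R B₁ = P := le_antisymm (Submodule.span_le.2 hB₁) hsp₁
  have hQ : Submodule.span R (B₀ ∪ B₂) = Q := by
    rw [Submodule.span_union, hsp₀, hsp₂, ← sup_inf_assoc_of_le D inf_le_right, hD.sup_eq_top,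
      top_inf_eq]
  have hdisj : Disjoint (Submodule.span R B₁) (Submodule.span R B₂) := by
    rw [hP, hsp₂, disjoint_iff_inf_le]
    calc P ⊓ (D ⊓ Q) ≤ (P ⊓ Q) ⊓ D :=
          le_inf (le_inf inf_le_left (inf_le_right.trans inf_le_right))
            (inf_le_right.trans inf_le_left)
      _ ≤ ⊥ := hD.disjoint.le_bot
  have hli := hli₁.id_union hli₂ hdisj
  let e := Module.Basis.extend hli
  have : Finite (hli.extend (Set.subset_univ _)) := Module.Finite.finite_basis e
  let b := e.reindex (Finite.equivFinOfCardEq (Module.finrank_eq_nat_card_basis e).symm)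
  have hrange : B₁ ∪ B₂ ⊆ Set.range b := by
    rw [Module.Basis.range_reindex, Module.Basis.range_extend]
    exact Module.Basis.subset_extend hli
  have key : ∀ B : Set V, B ⊆ B₁ ∪ B₂ → ∃ X, Submodule.span R B = coordSpan b X := by
    intro B hB
    obtain ⟨s, rfl⟩ := Set.subset_range_iff_exists_image_eq.1 (hB.trans hrange)
    exact ⟨(Set.toFinite s).toFinset, by rw [coordSpan, Set.Finite.coe_toFinset]⟩
  obtain ⟨X, hX⟩ := key B₁ Set.subset_union_left
  obtain ⟨Y, hY⟩ := key (B₀ ∪ B₂) (Set.union_subset_union_left _ hB₀₁)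
  exact ⟨b, X, Y, hP.symm.trans hX, hQ.symm.trans hY⟩

theorem exists_apartmentMap [FiniteDimensional R V] {k : ℕ} (P Q : Grassmannian R V k) :
    ∃ (b : Module.Basis (Fin (Module.finrank R V)) R V)
      (X Y : {X : Finset (Fin (Module.finrank R V)) // X.card = k}),
      P = apartmentMap b X ∧ Q = apartmentMap b Y := by
  obtain ⟨b, X, Y, hX, hY⟩ := exists_basis_coordSpan P.1 Q.1
  exact ⟨b, ⟨X, by rw [← finrank_coordSpan b, ← hX, P.2]⟩,
    ⟨Y, by rw [← finrank_coordSpan b, ← hY, Q.2]⟩, Subtype.ext hX, Subtype.ext hY⟩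

theorem apartmentMap_injective {k : ℕ} : Function.Injective (apartmentMap b (k := k)) := by
  intro X Y hXY
  have h : coordSpan b X.1 = coordSpan b Y.1 := congrArg Subtype.val hXY
  refine Subtype.ext (Finset.ext fun i => ?_)
  rw [← basis_mem_coordSpan_iff b, h, basis_mem_coordSpan_iff]

theorem grassmannGraph_dist [FiniteDimensional R V] {k : ℕ} (P Q : Grassmannian R V k) :
    (grassmannGraph R V k).dist P Q =
      k - Module.finrank R (P.1 ⊓ Q.1 : Submodule R V) := by
  have hle : ∀ P Q : Grassmannian R V k, Module.finrank R (P.1 ⊓ Q.1 : Submodule R V) ≤ k :=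
    fun P Q => (Submodule.finrank_mono inf_le_left).trans P.2.le
  refine dist_eq_of_step
    (δ := fun P Q : Grassmannian R V k => k - Module.finrank R (P.1 ⊓ Q.1 : Submodule R V))
    (fun P => ?_) ?_ ?_ P Q
  · rw [inf_idem, P.2, Nat.sub_self]
  · intro P Q U hPQ
    have h1 := isRank_finrank.add_le_inf_add (inf_le_right : P.1 ⊓ Q.1 ≤ Q.1)
      (inf_le_left : Q.1 ⊓ U.1 ≤ Q.1)
    have h2 : P.1 ⊓ Q.1 ⊓ (Q.1 ⊓ U.1) ≤ P.1 ⊓ U.1 :=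
      inf_le_inf inf_le_left inf_le_right
    have h3 := Submodule.finrank_mono (R := R) h2
    have h4 := hPQ.2
    have h5 := Q.2
    omega
  · intro P U hPU
    obtain ⟨b, X, Z, rfl, rfl⟩ := exists_apartmentMap P U
    obtain ⟨Y, hXY, hYZ⟩ := exists_johnsonGraph_adj fun h => hPU (congrArg (apartmentMap b) h)
    refine ⟨apartmentMap b Y, ⟨fun h => hXY.1 (apartmentMap_injective b h), ?_⟩, ?_⟩
    · exact (congrArg (· + 1) (finrank_coordSpan_inf b X.1 Y.1)).trans hXY.2
    · have h1 : Module.finrank R ((apartmentMap b X).1 ⊓ (apartmentMap b Z).1 : Submodule R V) =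
        (X.1 ∩ Z.1).card := finrank_coordSpan_inf b X.1 Z.1
      have h2 : Module.finrank R ((apartmentMap b Y).1 ⊓ (apartmentMap b Z).1 : Submodule R V) =
        (Y.1 ∩ Z.1).card := finrank_coordSpan_inf b Y.1 Z.1
      have h3 := Finset.card_sdiff_add_card_inter X.1 Z.1
      have h4 := Finset.card_sdiff_add_card_inter Y.1 Z.1
      have h5 := X.2
      have h6 := Y.2
      rw [h1, h2]
      omega

/-- The base obtained from `b` by adding the `j`-th vector to the `i`-th one. -/
theorem exists_transvection [FiniteDimensional R V]
    (b : Module.Basis (Fin (Module.finrank R V)) R V) {i j : Fin (Module.finrank R V)}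
    (hij : i ≠ j) :
    ∃ b' : Module.Basis (Fin (Module.finrank R V)) R V,
      b' i = b i + b j ∧ ∀ l, l ≠ i → b' l = b l := by
  let v := Function.update (⇑b) i (b i + b j)
  have hvi : v i = b i + b j := Function.update_self ..
  have hvl : ∀ l, l ≠ i → v l = b l := fun l hl => Function.update_of_ne hl _ _
  have hsp : ⊤ ≤ Submodule.span R (Set.range v) := by
    rw [← b.span_eq, Submodule.span_le]
    rintro _ ⟨l, rfl⟩
    by_cases hl : l = i
    · subst hl
      have : b l = v l - v j := by rw [hvi, hvl j hij.symm, add_sub_cancel_right]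
      rw [this]
      exact sub_mem (Submodule.subset_span ⟨l, rfl⟩) (Submodule.subset_span ⟨j, rfl⟩)
    · exact Submodule.subset_span ⟨l, hvl l hl⟩
  refine ⟨basisOfTopLeSpanOfCardEqFinrank v hsp (Fintype.card_fin _), ?_, fun l hl => ?_⟩
  · rw [coe_basisOfTopLeSpanOfCardEqFinrank, hvi]
  · rw [coe_basisOfTopLeSpanOfCardEqFinrank, hvl l hl]

/-- The elements common to the apartments of a base and of its transvection. -/
theorem exists_coordSpan_eq_iff {b b' : Module.Basis ι R V} {i j : ι} (hij : i ≠ j)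
    (hi : b' i = b i + b j) (hl : ∀ l, l ≠ i → b' l = b l) (X : Finset ι) :
    (∃ Y : Finset ι, Y.card = X.card ∧ coordSpan b' Y = coordSpan b X) ↔ ¬ (i ∈ X ∧ j ∉ X) := by
  classical
  constructor
  · rintro ⟨Y, hYc, hY⟩ ⟨hiX, hjX⟩
    have hmem : ∀ y ∈ Y, b' y ∈ coordSpan b X := fun y hy =>
      hY ▸ (basis_mem_coordSpan_iff b').2 hy
    have hiY : i ∉ Y := by
      intro h
      have h1 := hmem i h
      rw [hi] at h1
      exact hjX ((basis_mem_coordSpan_iff b).1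
        ((Submodule.add_mem_iff_right _ ((basis_mem_coordSpan_iff b).2 hiX)).1 h1))
    have hYX : Y ⊆ X := fun y hy => by
      have h1 := hmem y hy
      rw [hl y fun h => hiY (h ▸ hy)] at h1
      exact (basis_mem_coordSpan_iff b).1 h1
    exact hiY (Finset.eq_of_subset_of_card_le hYX hYc.ge ▸ hiX)
  · intro h
    refine ⟨X, rfl, ?_⟩
    have hX : i ∈ X → j ∈ X := fun hi => by tauto
    apply le_antisymm
    · rw [coordSpan, Submodule.span_le]
      rintro _ ⟨x, hx, rfl⟩
      by_cases hxi : x = i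
      · subst hxi
        rw [hi]
        exact add_mem ((basis_mem_coordSpan_iff b).2 hx) ((basis_mem_coordSpan_iff b).2 (hX hx))
      · rw [hl x hxi]
        exact (basis_mem_coordSpan_iff b).2 hx
    · rw [coordSpan, Submodule.span_le]
      rintro _ ⟨x, hx, rfl⟩
      by_cases hxi : x = i
      · subst hxi
        have : b x = b' x - b' j := by rw [hi, hl j hij.symm, add_sub_cancel_right]
        rw [this]
        exact sub_mem ((basis_mem_coordSpan_iff b').2 hx)
          ((basis_mem_coordSpan_iff b').2 (hX hx))
      · rw [← hl x hxi]
        exact (basis_mem_coordSpan_iff b').2 hx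

end Apartment

/-! ### Permutations of `k`-sets -/

section Permutation

variable {ι : Type*} [DecidableEq ι] [Fintype ι] {k : ℕ}

theorem eq_of_forall_mem_notMem_iff (hk : 2 ≤ k) (hn : k + 2 ≤ Fintype.card ι) {i j u v : ι}
    (hij : i ≠ j) (huv : u ≠ v)
    (h : ∀ X : Finset ι, X.card = k → (i ∈ X ∧ j ∉ X ↔ u ∈ X ∧ v ∉ X)) : i = u ∧ j = v := by
  have hiu : i = u := by
    by_contra hiu
    obtain ⟨X, hX1, hX2, hX⟩ := Finset.exists_subsuperset_card_eq (n := k)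
      (s := {i}) (t := {j, u}ᶜ) (by simp [hij, hiu]) (by rw [Finset.card_singleton]; omega)
      (by rw [Finset.card_compl]; have := Finset.card_le_two (a := j) (b := u); omega)
    have hu : u ∉ X := fun h => by simpa using hX2 h
    have hj : j ∉ X := fun h => by simpa using hX2 h
    exact hu ((h X hX).1 ⟨hX1 (by simp), hj⟩).1
  subst hiu
  refine ⟨rfl, ?_⟩
  by_contra hjv
  obtain ⟨X, hX1, hX2, hX⟩ := Finset.exists_subsuperset_card_eq (n := k)
    (s := {i, v}) (t := {j}ᶜ)
    (by intro x; simp only [Finset.mem_insert, Finset.mem_singleton, Finset.mem_compl]; grind)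
    (by have := Finset.card_le_two (a := i) (b := v); omega)
    (by rw [Finset.card_compl, Finset.card_singleton]; omega)
  have hj : j ∉ X := fun h => by simpa using hX2 h
  exact ((h X hX).1 ⟨hX1 (by simp), hj⟩).2 (hX1 (by simp))

/-- A permutation of the `k`-element sets that preserves the class of the families
`{X | i ∈ X ∧ j ∉ X}` preserves the cardinality of the intersections. -/
theorem card_inter_eq_of_perm (hk : 2 ≤ k) (hn : k + 2 ≤ Fintype.card ι)
    (σ : Equiv.Perm {X : Finset ι // X.card = k})
    (hσ : ∀ i j : ι, i ≠ j → ∃ i' j' : ι, i' ≠ j' ∧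
      ∀ X, i' ∈ (σ X).1 ∧ j' ∉ (σ X).1 ↔ i ∈ X.1 ∧ j ∉ X.1) (X Y) :
    (X.1 ∩ Y.1).card = ((σ X).1 ∩ (σ Y).1).card := by
  have hτ : ∀ p : ι × ι, ∃ q : ι × ι, p.1 ≠ p.2 →
      ∀ X, q.1 ∈ (σ X).1 ∧ q.2 ∉ (σ X).1 ↔ p.1 ∈ X.1 ∧ p.2 ∉ X.1 := by
    intro p
    by_cases hp : p.1 = p.2
    · exact ⟨p, fun h => absurd hp h⟩
    · obtain ⟨i', j', -, h⟩ := hσ p.1 p.2 hp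
      exact ⟨(i', j'), fun _ => h⟩
  choose τ hτ using hτ
  have hle : ∀ X Y : {X : Finset ι // X.card = k},
      (X.1 ∩ Y.1).card ≤ ((σ X).1 ∩ (σ Y).1).card := by
    intro X Y
    have hcard : ((X.1 ∩ Y.1) ×ˢ (X.1 ∪ Y.1)ᶜ).card ≤
        (((σ X).1 ∩ (σ Y).1) ×ˢ ((σ X).1 ∪ (σ Y).1)ᶜ).card := by
      have hne : ∀ p : ι × ι, p ∈ (X.1 ∩ Y.1) ×ˢ (X.1 ∪ Y.1)ᶜ →
          p.1 ≠ p.2 ∧ (p.1 ∈ X.1 ∧ p.2 ∉ X.1) ∧ (p.1 ∈ Y.1 ∧ p.2 ∉ Y.1) := by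
        intro p hp
        simp only [Finset.mem_product, Finset.mem_inter, Finset.mem_compl, Finset.mem_union,
          not_or] at hp
        exact ⟨fun h => hp.2.1 (h ▸ hp.1.1), ⟨hp.1.1, hp.2.1⟩, hp.1.2, hp.2.2⟩
      refine Finset.card_le_card_of_injOn τ (fun p hp => ?_) fun p hp q hq hpq => ?_
      · obtain ⟨h0, h1, h2⟩ := hne p hp
        have h3 := (hτ p h0 X).2 h1
        have h4 := (hτ p h0 Y).2 h2
        simp only [Finset.coe_product, Set.mem_prod, Finset.mem_coe, Finset.mem_inter,
          Finset.mem_compl, Finset.mem_union, not_or]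
        exact ⟨⟨h3.1, h4.1⟩, h3.2, h4.2⟩
      · obtain ⟨h0, -, -⟩ := hne p hp
        obtain ⟨h0', -, -⟩ := hne q hq
        obtain ⟨h1, h2⟩ := eq_of_forall_mem_notMem_iff hk hn h0 h0' fun Z hZ => by
          rw [← hτ p h0 ⟨Z, hZ⟩, ← hτ q h0' ⟨Z, hZ⟩, hpq]
        exact Prod.ext h1 h2
    rw [Finset.card_product, Finset.card_product, Finset.card_compl, Finset.card_compl] at hcard
    have h1 := Finset.card_union_add_card_inter X.1 Y.1
    have h2 := Finset.card_union_add_card_inter (σ X).1 (σ Y).1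
    have h3 := Finset.card_le_univ ((σ X).1 ∪ (σ Y).1)
    rw [X.2, Y.2] at h1
    rw [(σ X).2, (σ Y).2] at h2
    by_contra hlt
    push Not at hlt
    have h4 : Fintype.card ι - ((σ X).1 ∪ (σ Y).1).card ≤
      Fintype.card ι - (X.1 ∪ Y.1).card := by omega
    -- A smaller intersection means a larger union, so both factors of the pair count would go the
    -- wrong way.
    have h5 := Nat.mul_lt_mul_of_lt_of_le hlt h4 (by omega)
    omega
  -- A permutation preserves the total over all pairs, so the termwise inequality is an equality.
  have hsum : ∑ p : {X : Finset ι // X.card = k} × {X : Finset ι // X.card = k},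
      (p.1.1 ∩ p.2.1).card = ∑ p : {X : Finset ι // X.card = k} × {X : Finset ι // X.card = k},
      ((σ p.1).1 ∩ (σ p.2).1).card :=
    ((σ.prodCongr σ).sum_comp fun p => (p.1.1 ∩ p.2.1).card).symm
  exact (Finset.sum_eq_sum_iff_of_le fun p _ => hle p.1 p.2).1 hsum (X, Y) (Finset.mem_univ _)

/-- If `k` or `n - k` is at most one, then distinct `k`-element sets of an `n`-element set have
`k - 1` common elements. -/
theorem card_inter_add_one (hkn : k ≤ 1 ∨ Fintype.card ι ≤ k + 1)
    {X Y : Finset ι} (hX : X.card = k) (hY : Y.card = k) (hXY : X ≠ Y) :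
    (X ∩ Y).card + 1 = k := by
  have h1 := Finset.card_union_add_card_inter X Y
  have h2 := Finset.card_le_univ (X ∪ Y)
  have h3 : (X ∩ Y).card < X.card := by
    refine Finset.card_lt_card ⟨Finset.inter_subset_left, fun h => hXY ?_⟩
    exact Finset.eq_of_subset_of_card_le (fun x hx => (Finset.mem_inter.1 (h hx)).2) (by omega)
  omega

theorem card_inter_eq_of_perm_of_le (hkn : k ≤ 1 ∨ Fintype.card ι ≤ k + 1)
    (σ : Equiv.Perm {X : Finset ι // X.card = k}) (X Y) :
    (X.1 ∩ Y.1).card = ((σ X).1 ∩ (σ Y).1).card := by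
  by_cases hXY : X = Y
  · rw [hXY, Finset.inter_self, Finset.inter_self, Y.2, (σ Y).2]
  · have h1 := card_inter_add_one hkn X.2 Y.2 fun h => hXY (Subtype.ext h)
    have h2 := card_inter_add_one hkn (σ X).2 (σ Y).2 fun h => hXY (σ.injective (Subtype.ext h))
    omega

end Permutation

/-! ### `J`-mappings -/

section JMapping

variable {R V R' V' : Type*} [DivisionRing R] [AddCommGroup V] [Module R V]
  [DivisionRing R'] [AddCommGroup V'] [Module R' V'] {k k' : ℕ} {f : Grassmannian R V k → Grassmannian R' V' k'}

/-- The extension of a family of subspaces indexed by the `k`-element sets to all finite sets. -/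
def extendZero {n : ℕ} (g : {X : Finset (Fin n) // X.card = k} → Grassmannian R' V' k')
    (X : Finset (Fin n)) : Submodule R' V' :=
  if h : X.card = k then (g ⟨X, h⟩).1 else ⊥

theorem extendZero_apply {n : ℕ}
    (g : {X : Finset (Fin n) // X.card = k} → Grassmannian R' V' k')
    (X : {X : Finset (Fin n) // X.card = k}) : extendZero g X.1 = (g X).1 :=
  dif_pos X.2

theorem isJohnsonEmbedding_extendZero [FiniteDimensional R' V'] {n : ℕ}
    {g : {X : Finset (Fin n) // X.card = k} → Grassmannian R' V' k'}
    (hg : IsIsometricEmbedding (johnsonGraph n k) (grassmannGraph R' V' k') g) :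
    IsJohnsonEmbedding (fun S : Submodule R' V' => (Module.finrank R' S : ℤ)) k k'
      (extendZero g) := by
  intro X Y hX hY
  have h1 := hg.dist_eq ⟨X, hX⟩ ⟨Y, hY⟩
  rw [grassmannGraph_dist, johnsonGraph_dist] at h1
  have h2 : Module.finrank R' ((g ⟨X, hX⟩).1 ⊓ (g ⟨Y, hY⟩).1 : Submodule R' V') ≤ k' :=
    (Submodule.finrank_mono inf_le_left).trans (g ⟨X, hX⟩).2.le
  rw [extendZero_apply g ⟨X, hX⟩, extendZero_apply g ⟨Y, hY⟩]
  simp only at h1 ⊢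
  omega

/-- On an apartment, a `J`-mapping is an isometric embedding of the Johnson graph up to a
permutation of the `k`-element sets. -/
theorem IsJMapping.exists_perm (hf : IsJMapping f)
    (b : Module.Basis (Fin (Module.finrank R V)) R V) :
    ∃ (g : {X : Finset (Fin (Module.finrank R V)) // X.card = k} → Grassmannian R' V' k')
      (σ : Equiv.Perm {X : Finset (Fin (Module.finrank R V)) // X.card = k}),
      IsIsometricEmbedding (johnsonGraph (Module.finrank R V) k) (grassmannGraph R' V' k') g ∧
        ∀ X, f (apartmentMap b X) = g (σ X) := by
  obtain ⟨g, hg, hJ⟩ := hf (apartment b k) ⟨b, rfl⟩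
  rw [apartment_eq_range, ← Set.range_comp] at hJ
  have h1 : ∀ X, ∃ Y, g Y = f (apartmentMap b X) := fun X => by
    have : f (apartmentMap b X) ∈ Set.range g := hJ ▸ ⟨X, rfl⟩
    exact this
  choose s hs using h1
  -- Injectivity on the apartment is not assumed: `s` is a surjection of a finite set to itself,
  -- hence bijective.
  have hsurj : Function.Surjective s := by
    intro Y
    have : g Y ∈ Set.range (f ∘ apartmentMap b) := hJ ▸ ⟨Y, rfl⟩
    obtain ⟨X, hX⟩ := this
    exact ⟨X, hg.injective (by rw [hs]; exact hX)⟩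
  exact ⟨g, Equiv.ofBijective s ⟨Finite.injective_iff_surjective.2 hsurj, hsurj⟩, hg,
    fun X => (hs X).symm⟩

theorem IsJMapping.injective [FiniteDimensional R V] (hf : IsJMapping f) : Function.Injective f := by
  intro P Q hPQ
  obtain ⟨b, X, Y, rfl, rfl⟩ := exists_apartmentMap P Q
  obtain ⟨g, σ, hg, hσ⟩ := hf.exists_perm b
  rw [hσ, hσ] at hPQ
  rw [σ.injective (hg.injective hPQ)]

/-- The transvected base loses the family of `(i, j)`. Global injectivity of `f` ensures that the
images share only the images of shared subspaces, so `exists_eq_filter` describes the loss in the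
labelling by `g`. -/
theorem IsJMapping.exists_mem_notMem_iff [FiniteDimensional R V] [FiniteDimensional R' V']
    (hf : IsJMapping f) (hk : 2 ≤ k) (hn : k + 2 ≤ Module.finrank R V) {b : Module.Basis (Fin (Module.finrank R V)) R V}
    {g : {X : Finset (Fin (Module.finrank R V)) // X.card = k} → Grassmannian R' V' k'}
    {σ : Equiv.Perm {X : Finset (Fin (Module.finrank R V)) // X.card = k}}
    (hg : IsIsometricEmbedding (johnsonGraph (Module.finrank R V) k) (grassmannGraph R' V' k') g)
    (hσ : ∀ X, f (apartmentMap b X) = g (σ X)) {i j : Fin (Module.finrank R V)} (hij : i ≠ j) :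
    ∃ i' j' : Fin (Module.finrank R V), i' ≠ j' ∧
      ∀ X, i' ∈ (σ X).1 ∧ j' ∉ (σ X).1 ↔ i ∈ X.1 ∧ j ∉ X.1 := by
  classical
  obtain ⟨b', hi, hl⟩ := exists_transvection b hij
  obtain ⟨g', σ', hg', hσ'⟩ := hf.exists_perm b'
  have key : ∀ X, (∃ Y : Finset (Fin (Module.finrank R V)), Y.card = k ∧
      extendZero g' Y = extendZero g (σ X).1) ↔ ¬ (i ∈ X.1 ∧ j ∉ X.1) := by
    intro X
    rw [← exists_coordSpan_eq_iff hij hi hl, extendZero_apply]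
    constructor
    · rintro ⟨Y, hY, hYX⟩
      rw [extendZero_apply g' ⟨Y, hY⟩] at hYX
      have h1 : f (apartmentMap b' (σ'.symm ⟨Y, hY⟩)) = f (apartmentMap b X) := by
        rw [hσ, hσ', Equiv.apply_symm_apply]
        exact Subtype.ext hYX
      exact ⟨(σ'.symm ⟨Y, hY⟩).1, by rw [(σ'.symm ⟨Y, hY⟩).2, X.2],
        congrArg Subtype.val (hf.injective h1)⟩
    · rintro ⟨Y, hY, hYX⟩
      rw [X.2] at hY
      have h1 : apartmentMap b' ⟨Y, hY⟩ = apartmentMap b X := Subtype.ext hYX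
      refine ⟨(σ' ⟨Y, hY⟩).1, (σ' ⟨Y, hY⟩).2, ?_⟩
      rw [extendZero_apply, ← hσ', h1, hσ]
  let N : Finset (Finset (Fin (Module.finrank R V))) := (Finset.univ.powersetCard k).filter
    fun X => ¬ ∃ Y : Finset (Fin (Module.finrank R V)), Y.card = k ∧
      extendZero g' Y = extendZero g X
  have hN : ∀ X, X ∈ N ↔ X.card = k ∧ ¬ ∃ Y : Finset (Fin (Module.finrank R V)), Y.card = k ∧
      extendZero g' Y = extendZero g X := fun X => by
    rw [Finset.mem_filter, Finset.mem_powersetCard_univ]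
  have hNσ : ∀ X, (σ X).1 ∈ N ↔ i ∈ X.1 ∧ j ∉ X.1 := fun X => by
    rw [hN, key X, not_not]
    exact and_iff_right (σ X).2
  have hNc : N.card = (Fintype.card (Fin (Module.finrank R V)) - 2).choose (k - 1) := by
    obtain ⟨l, rfl⟩ := Nat.exists_eq_add_of_le' (show 1 ≤ k by omega)
    rw [Nat.add_sub_cancel, ← card_filter_mem_notMem l hij]
    symm
    refine Finset.card_bij (fun X hX => (σ ⟨X, Finset.mem_powersetCard_univ.1
      (Finset.mem_filter.1 hX).1⟩).1) (fun X hX => ?_) (fun X hX Y hY h => ?_) fun Y hY => ?_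
    · exact (hNσ _).2 (Finset.mem_filter.1 hX).2
    · exact congrArg Subtype.val (σ.injective (Subtype.ext h))
    · have hYc := ((hN Y).1 hY).1
      have h1 : (σ (σ.symm ⟨Y, hYc⟩)).1 = Y := by rw [Equiv.apply_symm_apply]
      refine ⟨(σ.symm ⟨Y, hYc⟩).1, ?_, h1⟩
      rw [Finset.mem_filter, Finset.mem_powersetCard_univ, ← hNσ, h1]
      exact ⟨(σ.symm ⟨Y, hYc⟩).2, hY⟩
  obtain ⟨i', j', hij', hX⟩ := exists_eq_filter isRank_finrank hk
    (by rwa [Fintype.card_fin]) (isJohnsonEmbedding_extendZero hg)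
    (isJohnsonEmbedding_extendZero hg') hN hNc
  exact ⟨i', j', hij', fun X => by rw [← hX _ (σ X).2, hNσ]⟩

theorem IsJMapping.dist_eq [FiniteDimensional R V] [FiniteDimensional R' V']
    (hf : IsJMapping f) (P Q : Grassmannian R V k) :
    (grassmannGraph R' V' k').dist (f P) (f Q) = (grassmannGraph R V k).dist P Q := by
  obtain ⟨b, X, Y, rfl, rfl⟩ := exists_apartmentMap P Q
  obtain ⟨g, σ, hg, hσ⟩ := hf.exists_perm b
  have hcard : (X.1 ∩ Y.1).card = ((σ X).1 ∩ (σ Y).1).card := by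
    by_cases hkn : k ≤ 1 ∨ Fintype.card (Fin (Module.finrank R V)) ≤ k + 1
    · exact card_inter_eq_of_perm_of_le hkn σ X Y
    · push Not at hkn
      rw [Fintype.card_fin] at hkn
      exact card_inter_eq_of_perm (by omega) (by rw [Fintype.card_fin]; omega) σ
        (fun i j hij => hf.exists_mem_notMem_iff (by omega) (by omega) hg hσ hij) X Y
  have h1 : Module.finrank R ((apartmentMap b X).1 ⊓ (apartmentMap b Y).1 : Submodule R V) =
    (X.1 ∩ Y.1).card := finrank_coordSpan_inf b X.1 Y.1
  have h2 := Finset.card_sdiff_add_card_inter (σ X).1 (σ Y).1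
  rw [(σ X).2] at h2
  rw [hσ, hσ, hg.dist_eq, johnsonGraph_dist, grassmannGraph_dist, h1]
  omega

end JMapping

end GrassmannJohnson

theorem theorem3p1 {R V R' V' : Type*}
    [DivisionRing R] [AddCommGroup V] [Module R V] [FiniteDimensional R V]
    [DivisionRing R'] [AddCommGroup V'] [Module R' V'] [FiniteDimensional R' V']
    (k k' : ℕ)
    (f : GrassmannJohnson.Grassmannian R V k → GrassmannJohnson.Grassmannian R' V' k')
    (hf : GrassmannJohnson.IsJMapping f) :
    GrassmannJohnson.IsIsometricEmbedding
      (GrassmannJohnson.grassmannGraph R V k) (GrassmannJohnson.grassmannGraph R' V' k') f where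
  injective := hf.injective
  adj_iff P Q := by
    rw [← SimpleGraph.dist_eq_one_iff_adj, ← SimpleGraph.dist_eq_one_iff_adj, hf.dist_eq]
  dist_eq := hf.dist_eq
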